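/- **Theorem 2 (double-chain algorithm, Markov sampling, constant stepsize).** *Setting.* Let $(S,A,P_{\rm env},r)$ be a finite Markov decision process, $\pi$ a fixed policy, $P(s'\mid s)=\sum_a P_{\rm env}(s'\mid s,a)\pi(a\mid s)$, $r_s=\sum_a\pi(a\mid s)r(s,a)$, $R=(r_s)_{s\in S}$ and $r_{\max}=\max_{s,a}|r(s,a)|$. Assume that $P$ is irreducible and aperiodic, with stationary distribution $\mu$; write $D=\mathrm{diag}(\mu)$, $e$ for the all-ones vector and $\Pi=I-e\mu^\top$. Let $\Phi\in\mathbb R^{S\times d}$, $d\ge1$, have linearly independent columns and rows $\phi(s)^\top$ with $\|\phi(s)\|\le1$ (Euclidean norm). Put $$\eta=\min_{\|x\|=1}\Big\{\tfrac12\sum_{s,s'}\mu(s)P(s'\mid s)\big((\Phi x)(s)-(\Phi x)(s')\big)^2+(\mu^\top\Phi x)^2\Big\},$$ and let $\theta^*$ be the solution of $\Phi^\top D(I-\Pi P)\Phi\theta^*=\Phi^\top D\Pi R$. For $\alpha>0$ let $\tau_{\rm mix}(\alpha)=\min\{\tau\ge 0:\ \|p_\tau(\cdot\mid s)-\mu\|_1\le\alpha\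 \text{for all } s\}$, where $p_\tau(\cdot\mid s)$ is the law of the chain after $\tau$ steps from $s$. Let $(s_t)$ and $(\hat s_t)$ be two independent Markov chains with transition matrix $P$ (arbitrary initial laws), let $\theta_0\in\mathbb R^d$ be deterministic, and with a constant stepsize $\alpha$ let $$\theta_{t+1}=\theta_t+\alpha\Big(-(r_{s_t}+\phi(s_t)^\top\theta_t)\,\phi(\hat s_t)+\big(r_{s_t}+\phi(s_{t+1})^\top\theta_t-\phi(s_t)^\top\theta_t\big)\phi(s_t)\Big).$$ Let $B=2\|\theta_0-\theta^*\|+r_{\max}+\|\theta^*\|$ and $G=42B^2+30(r_{\max}+\|\theta^*\|)^2$. *Claims.* 1. If $\alpha>0$, $\tau_{\rm mix}=\tau_{\rm mix}(\alpha)$ and $\alpha\le\dfrac{\eta B^2}{(3\tau_{\rm mix}+1)G}$, then for all $T\ge\tau_{\rm mix}$ $$\mathbb E\|\theta_T-\theta^*\|^2\le e^{-2\alpha\eta(T-\tau_{\rm mix})}B^2+\frac{\alpha G(3\tau_{\rm mix}+1)}{2\eta}.$$ 2. There are $C>1$ and $\beta\in[0,1)$ with $\|p_\tau(\cdot\mid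 s)-\mu\|_1\le C\beta^\tau$ for all $\tau\ge0$ and $s\in S$. For any such $C,\beta$ put $L=\max\{1,(\log C+1)/\log(1/\beta)\}$ (with $L=1$ if $\beta=0$). The stepsize $\alpha=\log T/(\eta T)$ then yields the rate $\tilde O(1/T)$ and the sample complexity $\tilde O(\varepsilon^{-1}\eta^{-2})$ in the following sense, with an absolute constant $K>0$ (independent of the decision process, the policy, the features, $d$, $\theta_0$, $C$, $\beta$, $T$ and $\varepsilon$): - for every integer $T\ge2$ with $T\ge K L\eta^{-2}\log^2T$, $$\mathbb E\|\theta_T-\theta^*\|^2\le K\,\frac{G\,L}{\eta^2}\cdot\frac{\log^2T}{T};$$ - for every $\varepsilon\in(0,1]$, with $N=(1+G)L\,\varepsilon^{-1}\eta^{-2}$, every integer $T\ge K\,N\log^2(2+N)$ satisfies $\mathbb E\|\theta_T-\theta^*\|^2\le\varepsilon$. -/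

import Mathlib

open MeasureTheory ProbabilityTheory Matrix

noncomputable section

namespace AvgRewardTD

/-- A finite Markov decision process `(S, A, P_env, r)`. -/
structure MDP (S A : Type*) [Fintype S] where
  /-- `trans s a s'` is the probability `P_env(s' ∣ s, a)`. -/
  trans : S → A → S → ℝ
  trans_mem : ∀ s a, trans s a ∈ stdSimplex ℝ S
  /-- The reward function `r(s, a)`. -/
  reward : S → A → ℝ

/-- A (randomized, stationary) policy; `prob s a` is `π(a ∣ s)`. -/
structure Policy (S A : Type*) [Fintype A] where
  prob : S → A → ℝ
  prob_mem : ∀ s, prob s ∈ stdSimplex ℝ A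

section MDP

variable {S A : Type*} [Fintype S] [Fintype A]

/-- `r_max = max_{s,a} |r(s,a)|`. -/
def MDP.rMax (M : MDP S A) : ℝ := ⨆ p : S × A, |M.reward p.1 p.2|

/-- The transition matrix induced by the policy: the entry `(s, s')` is `P(s' ∣ s)`. -/
def MDP.transMatrix (M : MDP S A) (π : Policy S A) : Matrix S S ℝ :=
  Matrix.of fun s s' => ∑ a, M.trans s a s' * π.prob s a

/-- The vector `R` of expected rewards `r_s = ∑_a π(a ∣ s) r(s,a)`. -/
def MDP.expReward (M : MDP S A) (π : Policy S A) : S → ℝ :=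
  fun s => ∑ a, π.prob s a * M.reward s a

end MDP

section Chain

variable {S : Type*} [Fintype S]

/-- `μ` is a stationary distribution of the transition matrix `P`. -/
def IsStationary (P : Matrix S S ℝ) (μ : S → ℝ) : Prop :=
  μ ∈ stdSimplex ℝ S ∧ μ ᵥ* P = μ

/-- Every state has period one: the return times `{n ≥ 1 : P^n(s,s) > 0}` have gcd `1`. -/
def IsAperiodic [DecidableEq S] (P : Matrix S S ℝ) : Prop :=
  ∀ s, Nat.setGcd {n : ℕ | 0 < n ∧ 0 < (P ^ n) s s} = 1

/-- The `ℓ¹` distance `‖p_τ(· ∣ s) - μ‖₁` of the law after `τ` steps from `s` to `μ`. -/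
def l1Dist [DecidableEq S] (P : Matrix S S ℝ) (μ : S → ℝ) (τ : ℕ) (s : S) : ℝ :=
  ∑ s', |(P ^ τ) s s' - μ s'|

/-- The mixing time `τ_mix(ε) = min {τ : max_s ‖p_τ(· ∣ s) - μ‖₁ ≤ ε}`. -/
def mixingTime [DecidableEq S] (P : Matrix S S ℝ) (μ : S → ℝ) (ε : ℝ) : ℕ :=
  sInf {τ : ℕ | ∀ s, l1Dist P μ τ s ≤ ε}

/-- `C` and `β` are constants of geometric mixing: `C > 1`, `β ∈ [0,1)` and
`‖p_τ(· ∣ s) - μ‖₁ ≤ C β^τ` for all `τ` and `s`. -/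
def IsGeometricMixing [DecidableEq S] (P : Matrix S S ℝ) (μ : S → ℝ) (C β : ℝ) : Prop :=
  1 < C ∧ 0 ≤ β ∧ β < 1 ∧ ∀ (τ : ℕ) (s : S), l1Dist P μ τ s ≤ C * β ^ τ

/-- The mixing factor `L = max {1, (log C + 1) / log (1/β)}`, read as `1` for `β = 0`. -/
def mixingFactor (C β : ℝ) : ℝ := max 1 ((Real.log C + 1) / Real.log (1 / β))

/-- The squared Dirichlet seminorm `½ ∑_{s,s'} μ(s) P(s' ∣ s) (f(s) - f(s'))²`. -/
def dirichletSq (P : Matrix S S ℝ) (μ f : S → ℝ) : ℝ :=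
  (1 / 2) * ∑ s, ∑ s', μ s * P s s' * (f s - f s') ^ 2

/-- Under the probability measure `Q`, the process `X` is a time-homogeneous Markov chain
with transition matrix `P` (the initial law is arbitrary). -/
def IsMarkovChain {Ω : Type*} [MeasurableSpace Ω] [MeasurableSpace S]
    (Q : Measure Ω) (P : Matrix S S ℝ) (X : ℕ → Ω → S) : Prop :=
  (∀ t, Measurable (X t)) ∧
    ∀ (t : ℕ) (x : ℕ → S),
      Q.real {ω | ∀ i ≤ t + 1, X i ω = x i}
        = Q.real {ω | ∀ i ≤ t, X i ω = x i} * P (x t) (x (t + 1))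

end Chain

section Algorithm

variable {S : Type*} [Fintype S] {d : ℕ}

/-- The feature vector `φ(s)`, i.e. the `s`-th row of the feature matrix. -/
def feature (Φ : Matrix S (Fin d) ℝ) (s : S) : EuclideanSpace ℝ (Fin d) :=
  WithLp.toLp 2 (Φ s)

/-- The condition number `η = min_{‖x‖ = 1} ‖Φ x‖_Dir² + (μᵀ Φ x)²`. -/
def conditionNumber (P : Matrix S S ℝ) (μ : S → ℝ) (Φ : Matrix S (Fin d) ℝ) : ℝ :=
  ⨅ x : Metric.sphere (0 : EuclideanSpace ℝ (Fin d)) 1,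
    dirichletSq P μ (Φ *ᵥ x.1.ofLp) + (μ ⬝ᵥ (Φ *ᵥ x.1.ofLp)) ^ 2

/-- The projection `Π = I - e μᵀ`. -/
def centering [DecidableEq S] (μ : S → ℝ) : Matrix S S ℝ :=
  1 - Matrix.vecMulVec (fun _ => 1) μ

/-- `θ` solves `Φᵀ D (I - Π P) Φ θ = Φᵀ D Π R`, where `D = diag(μ)`. -/
def IsFixedPoint [DecidableEq S] (P : Matrix S S ℝ) (μ R : S → ℝ) (Φ : Matrix S (Fin d) ℝ)
    (θ : EuclideanSpace ℝ (Fin d)) : Prop :=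
  (Φᵀ * Matrix.diagonal μ * (1 - centering μ * P) * Φ) *ᵥ θ.ofLp
    = (Φᵀ * Matrix.diagonal μ * centering μ) *ᵥ R

/-- `f(s, ŝ, θ) = -(r_s + φ(s)ᵀ θ) φ(ŝ)`. -/
def fUpdate (R : S → ℝ) (Φ : Matrix S (Fin d) ℝ) (s sHat : S)
    (θ : EuclideanSpace ℝ (Fin d)) : EuclideanSpace ℝ (Fin d) :=
  -((R s + inner ℝ (feature Φ s) θ) • feature Φ sHat)

/-- `g(s, s', θ) = (r_s + φ(s')ᵀ θ - φ(s)ᵀ θ) φ(s)`. -/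
def gUpdate (R : S → ℝ) (Φ : Matrix S (Fin d) ℝ) (s s' : S)
    (θ : EuclideanSpace ℝ (Fin d)) : EuclideanSpace ℝ (Fin d) :=
  (R s + inner ℝ (feature Φ s') θ - inner ℝ (feature Φ s) θ) • feature Φ s

/-- The double-chain iterates `θ_t` with stepsizes `α_t`, along the two state trajectories
`s` and `sHat`; the successor `s_t'` of `s_t` is the next state `s_{t+1}` of the first chain. -/
def doubleChain (R : S → ℝ) (Φ : Matrix S (Fin d) ℝ) (α : ℕ → ℝ)
    (θ₀ : EuclideanSpace ℝ (Fin d)) (s sHat : ℕ → S) : ℕ → EuclideanSpace ℝ (Fin d)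
  | 0 => θ₀
  | t + 1 =>
    let θ := doubleChain R Φ α θ₀ s sHat t
    θ + α t • (fUpdate R Φ (s t) (sHat t) θ + gUpdate R Φ (s t) (s (t + 1)) θ)

/-- `B = 2 ‖θ₀ - θ*‖ + r_max + ‖θ*‖`. -/
def constB (rMax : ℝ) (θ₀ θstar : EuclideanSpace ℝ (Fin d)) : ℝ :=
  2 * ‖θ₀ - θstar‖ + rMax + ‖θstar‖

/-- `G = 42 B² + 30 (r_max + ‖θ*‖)²`. -/
def constG (rMax : ℝ) (θ₀ θstar : EuclideanSpace ℝ (Fin d)) : ℝ :=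
  42 * constB rMax θ₀ θstar ^ 2 + 30 * (rMax + ‖θstar‖) ^ 2

/-- The mean square error `E ‖θ_T - θ*‖²` of the double-chain algorithm with constant
stepsize `α`, driven by the random trajectories `s` and `sHat`. -/
def meanSqError {Ω : Type*} [MeasurableSpace Ω] (Q : Measure Ω) (R : S → ℝ)
    (Φ : Matrix S (Fin d) ℝ) (α : ℝ) (θ₀ θstar : EuclideanSpace ℝ (Fin d))
    (s sHat : ℕ → Ω → S) (T : ℕ) : ℝ :=
  ∫ ω, ‖doubleChain R Φ (fun _ => α) θ₀ (fun t => s t ω) (fun t => sHat t ω) T - θstar‖ ^ 2 ∂Q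

end Algorithm

end AvgRewardTD

end

/-! Write `f = Φ(θ - θ*)`. Under stationary sampling the mean update is affine in `θ` and vanishes
at `θ*` (`meanUpdate_eq_zero`). Independence of the second chain factors the mean of `f(s) f(ŝ)`
into `(μᵀf)²`, so the inner product of the mean update with the error is minus the Dirichlet energy
of `f` minus `(μᵀf)²` (`inner_meanUpdate_sub`), hence at most `-η‖θ - θ*‖²`. With unbiased sampling
the mean square error would contract by `1 - 2αη` per step up to `O(α²)`.

Markov sampling adds a noise term correlated with the iterate. It is evaluated at the iterate from
`τ` steps earlier. The replacement costs `O(ατ)`, since each step moves the iterate by `O(α)`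
(`noise_sub_le`, `norm_doubleChain_add_sub_le`). Given the paths up to the earlier time, the current
states are `α`-close to stationarity, so the delayed noise has mean `O(α)`
(`sum_tripleLaw_noise_le`). Both enter the recursion with a further factor `α`
(`meanSqError_succ_le`). No projection is needed: up to time `τ` the iterates are bounded
deterministically, and the stepsize condition then propagates the second moment bound `B²` by
induction (`meanSqError_le`).

For the rate, a Doeblin minorization gives geometric mixing, so the mixing time at `α = log T /
(ηT)` is `O(L log T)`. Positivity of `η` comes from compactness of the sphere and primitivity of
`P`. The sample complexity inverts the rate (`mul_log_sq_le_of_le`). -/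

noncomputable section

namespace AvgRewardTD

/-! ### Stochastic matrices, primitivity and geometric mixing. -/

section Stochastic

variable {S : Type*} [Fintype S]

/-- `P` is a stochastic matrix: each row is a probability distribution. -/
def IsStochastic (P : Matrix S S ℝ) : Prop := ∀ s, P s ∈ stdSimplex ℝ S

lemma MDP.isStochastic_transMatrix {A : Type*} [Fintype A] (M : MDP S A) (π : Policy S A) :
    IsStochastic (M.transMatrix π) := by
  intro s
  refine ⟨fun s' => Finset.sum_nonneg fun a _ =>
    mul_nonneg ((M.trans_mem s a).1 s') ((π.prob_mem s).1 a), ?_⟩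
  simp only [MDP.transMatrix, Matrix.of_apply]
  rw [Finset.sum_comm]
  simp_rw [← Finset.sum_mul, (M.trans_mem s _).2, one_mul]
  exact (π.prob_mem s).2

lemma MDP.abs_expReward_le {A : Type*} [Fintype A] (M : MDP S A) (π : Policy S A) (s : S) :
    |M.expReward π s| ≤ M.rMax := by
  have h : ∀ a, |M.reward s a| ≤ M.rMax := fun a =>
    le_ciSup (f := fun p : S × A => |M.reward p.1 p.2|) (Set.finite_range _).bddAbove (s, a)
  calc |M.expReward π s| ≤ ∑ a, |π.prob s a * M.reward s a| := Finset.abs_sum_le_sum_abs _ _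
    _ ≤ ∑ a, π.prob s a * M.rMax := by
        refine Finset.sum_le_sum fun a _ => ?_
        rw [abs_mul, abs_of_nonneg ((π.prob_mem s).1 a)]
        exact mul_le_mul_of_nonneg_left (h a) ((π.prob_mem s).1 a)
    _ = M.rMax := by rw [← Finset.sum_mul, (π.prob_mem s).2, one_mul]

lemma MDP.rMax_nonneg {A : Type*} [Fintype A] (M : MDP S A) : 0 ≤ M.rMax :=
  Real.iSup_nonneg fun _ => abs_nonneg _

lemma IsStochastic.mul {P P' : Matrix S S ℝ} (hP : IsStochastic P) (hP' : IsStochastic P') :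
    IsStochastic (P * P') := by
  intro s
  refine ⟨fun s' => Finset.sum_nonneg fun u _ => mul_nonneg ((hP s).1 u) ((hP' u).1 s'), ?_⟩
  simp only [Matrix.mul_apply]
  rw [Finset.sum_comm]
  simp_rw [← Finset.mul_sum, (hP' _).2, mul_one]
  exact (hP s).2

variable [DecidableEq S]

lemma IsStochastic.one : IsStochastic (1 : Matrix S S ℝ) := by
  intro s
  refine ⟨fun s' => ?_, ?_⟩
  · rw [Matrix.one_apply]; split_ifs <;> norm_num
  · simp [Matrix.one_apply]

lemma IsStochastic.pow {P : Matrix S S ℝ} (hP : IsStochastic P) (n : ℕ) :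
    IsStochastic (P ^ n) := by
  induction n with
  | zero => simpa using IsStochastic.one
  | succ n ih => rw [pow_succ]; exact ih.mul hP

lemma IsStationary.vecMul_pow {P : Matrix S S ℝ} {μ : S → ℝ} (h : IsStationary P μ) (n : ℕ) :
    μ ᵥ* (P ^ n) = μ := by
  induction n with
  | zero => simp
  | succ n ih => rw [pow_succ, ← Matrix.vecMul_vecMul, ih, h.2]

lemma IsStochastic.pow_add_pos {P : Matrix S S ℝ} (hP : IsStochastic P) {m n : ℕ} {i j k : S}
    (hm : 0 < (P ^ m) i j) (hn : 0 < (P ^ n) j k) : 0 < (P ^ (m + n)) i k := by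
  rw [pow_add, Matrix.mul_apply]
  exact Finset.sum_pos' (fun u _ => mul_nonneg ((hP.pow m i).1 u) ((hP.pow n u).1 k))
    ⟨j, Finset.mem_univ _, mul_pos hm hn⟩

/-- An irreducible aperiodic stochastic matrix is primitive. -/
lemma IsStochastic.isPrimitive {P : Matrix S S ℝ} (hP : IsStochastic P)
    (hirr : P.IsIrreducible) (hap : IsAperiodic P) : P.IsPrimitive := by
  have hret : ∀ s, ∃ n, ∀ m ≥ n, 0 < (P ^ m) s s := by
    intro s
    -- Return times are closed under addition, and an additive semigroup of integers with gcd one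
    -- contains every large integer.
    obtain ⟨n, hn⟩ := Nat.exists_mem_closure_of_ge {n : ℕ | 0 < n ∧ 0 < (P ^ n) s s}
    refine ⟨n, fun m hm => ?_⟩
    refine AddSubmonoid.closure_induction (motive := fun m _ => 0 < (P ^ m) s s) (fun m hm => hm.2)
      (by simp) (fun a b _ _ ha hb => hP.pow_add_pos ha hb) (hn m hm (by rw [hap s]; simp))
  choose n hn using hret
  choose k _ hk using (Matrix.isIrreducible_iff_exists_pow_pos hirr.nonneg).1 hirr
  -- This exponent exceeds `n i + k i j` for every pair: loop at `i` for the surplus time, then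
  -- travel to `j`.
  refine ⟨hirr.nonneg, (∑ s, n s) + (∑ s, ∑ s', k s s') + 1, by omega, fun i j => ?_⟩
  have h1 : n i ≤ ∑ s, n s := Finset.single_le_sum (fun _ _ => Nat.zero_le _) (Finset.mem_univ i)
  have h2 : k i j ≤ ∑ s, ∑ s', k s s' :=
    (Finset.single_le_sum (f := fun s' => k i s') (fun _ _ => Nat.zero_le _)
      (Finset.mem_univ j)).trans
    (Finset.single_le_sum (f := fun s => ∑ s', k s s') (fun _ _ => Nat.zero_le _)
      (Finset.mem_univ i))
  set a := (∑ s, n s) + (∑ s, ∑ s', k s s') + 1 with ha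
  obtain ⟨m, hm⟩ : ∃ m, a = m + k i j := ⟨a - k i j, by omega⟩
  rw [hm]
  exact hP.pow_add_pos (hn i m (by omega)) (hk i j)

lemma IsStationary.pos {P : Matrix S S ℝ} {μ : S → ℝ} (hμ : IsStationary P μ)
    (hprim : P.IsPrimitive) (s : S) : 0 < μ s := by
  obtain ⟨k, -, hk⟩ := hprim.exists_pos_pow
  rw [← hμ.vecMul_pow k]
  obtain ⟨u, hu⟩ : ∃ u, 0 < μ u := by
    by_contra! h
    have h0 : ∑ u, μ u ≤ 0 := Finset.sum_nonpos fun u _ => h u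
    have := hμ.1.2
    linarith
  exact Finset.sum_pos' (fun u _ => mul_nonneg (hμ.1.1 u) (hk u s).le)
    ⟨u, Finset.mem_univ _, mul_pos hu (hk u s)⟩

lemma l1Dist_le_two {P : Matrix S S ℝ} (hP : IsStochastic P) {μ : S → ℝ}
    (hμ : IsStationary P μ) (τ : ℕ) (s : S) : l1Dist P μ τ s ≤ 2 := by
  calc l1Dist P μ τ s ≤ ∑ s', ((P ^ τ) s s' + μ s') := by
        refine Finset.sum_le_sum fun s' _ => ?_
        have h1 := (hP.pow τ s).1 s'
        have h2 := hμ.1.1 s'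
        rw [abs_le]; constructor <;> linarith
    _ = 2 := by
        rw [Finset.sum_add_distrib, (hP.pow τ s).2, hμ.1.2]; norm_num

/-- Doeblin's contraction: if `P ^ n` dominates `δ e μᵀ`, then `n` more steps shrink the `ℓ¹`
distance to stationarity by the factor `1 - δ`. -/
lemma l1Dist_add_le {P : Matrix S S ℝ} (hP : IsStochastic P) {μ : S → ℝ}
    (hμ : IsStationary P μ) {n : ℕ} {δ : ℝ} (hδ : ∀ i j, δ * μ j ≤ (P ^ n) i j)
    (τ : ℕ) (s : S) : l1Dist P μ (τ + n) s ≤ (1 - δ) * l1Dist P μ τ s := by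
  -- The signed weights sum to zero, so subtracting `δ * μ s'` from every row is free; what remains
  -- is nonnegative with row sums `1 - δ`.
  have key : ∀ s', (P ^ (τ + n)) s s' - μ s'
      = ∑ u, ((P ^ τ) s u - μ u) * ((P ^ n) u s' - δ * μ s') := by
    intro s'
    have h1 : ∑ u, μ u * (P ^ n) u s' = μ s' := congrFun (hμ.vecMul_pow n) s'
    have h2 : ∑ u, ((P ^ τ) s u - μ u) = 0 := by
      rw [Finset.sum_sub_distrib, (hP.pow τ s).2, hμ.1.2, sub_self]
    simp_rw [mul_sub, Finset.sum_sub_distrib, ← Finset.sum_mul, h2, sub_mul,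
      Finset.sum_sub_distrib, h1, pow_add, Matrix.mul_apply]
    ring
  calc l1Dist P μ (τ + n) s
      ≤ ∑ s', ∑ u, |(P ^ τ) s u - μ u| * ((P ^ n) u s' - δ * μ s') := by
        refine Finset.sum_le_sum fun s' _ => ?_
        rw [key]
        refine (Finset.abs_sum_le_sum_abs _ _).trans (Finset.sum_le_sum fun u _ => ?_)
        rw [abs_mul, abs_of_nonneg (sub_nonneg.2 (hδ u s'))]
    _ = ∑ u, |(P ^ τ) s u - μ u| * (1 - δ) := by
        rw [Finset.sum_comm]
        refine Finset.sum_congr rfl fun u _ => ?_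
        rw [← Finset.mul_sum, Finset.sum_sub_distrib, ← Finset.mul_sum, (hP.pow n u).2, hμ.1.2,
          mul_one]
    _ = (1 - δ) * l1Dist P μ τ s := by
        rw [← Finset.sum_mul, mul_comm]; rfl

/-- A strictly positive power satisfies a Doeblin condition, and the resulting contraction is
iterated over blocks of length `n`. -/
lemma exists_isGeometricMixing {P : Matrix S S ℝ} (hP : IsStochastic P)
    (hprim : P.IsPrimitive) {μ : S → ℝ} (hμ : IsStationary P μ) :
    ∃ C β : ℝ, IsGeometricMixing P μ C β := by
  obtain ⟨n, hn, hpos⟩ := hprim.exists_pos_pow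
  obtain ⟨δ, hδ0, hδ⟩ : ∃ δ > 0, ∀ p : S × S, δ ≤ (P ^ n) p.1 p.2 := by
    cases isEmpty_or_nonempty S
    · exact ⟨1, one_pos, fun p => isEmptyElim p.1⟩
    · obtain ⟨p, hp⟩ := Finite.exists_min fun p : S × S => (P ^ n) p.1 p.2
      exact ⟨_, hpos p.1 p.2, hp⟩
  -- The cap keeps `1 - ε` positive, as the root and the constant below require.
  set ε := min δ (1 / 2) with hε
  have hε0 : 0 < ε := lt_min hδ0 (by norm_num)
  have hε1 : ε ≤ 1 / 2 := min_le_right _ _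
  have hdoeb : ∀ i j, ε * μ j ≤ (P ^ n) i j := by
    intro i j
    have h1 : μ j ≤ 1 := by
      rw [← hμ.1.2]
      exact Finset.single_le_sum (fun i _ => hμ.1.1 i) (Finset.mem_univ j)
    have h2 := hμ.1.1 j
    have h3 := hδ (i, j)
    have h4 : ε ≤ δ := min_le_left _ _
    nlinarith
  have hstep : ∀ (q r : ℕ) (s : S), l1Dist P μ (r + n * q) s ≤ (1 - ε) ^ q * 2 := by
    intro q r s
    induction q with
    | zero => simpa using l1Dist_le_two hP hμ r s
    | succ q ih =>
      rw [Nat.mul_succ, ← add_assoc, pow_succ']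
      refine (l1Dist_add_le hP hμ hdoeb _ s).trans ?_
      rw [mul_assoc]
      exact mul_le_mul_of_nonneg_left ih (by linarith)
  set β : ℝ := (1 - ε) ^ ((n : ℝ)⁻¹) with hβ
  have hβ0 : 0 < β := Real.rpow_pos_of_pos (by linarith) _
  have hβ1 : β < 1 := Real.rpow_lt_one (by linarith) (by linarith) (by positivity)
  have hβn : β ^ n = 1 - ε := by
    rw [hβ, Real.rpow_inv_natCast_pow (by linarith) (by omega)]
  -- The `2` bounds any `ℓ¹` distance; `1 / (1 - ε) = β⁻ⁿ` pays for the incomplete last block.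
  refine ⟨2 / (1 - ε), β, ?_, hβ0.le, hβ1, fun τ s => ?_⟩
  · rw [lt_div_iff₀ (by linarith)]; linarith
  · have h1 := hstep (τ / n) (τ % n) s
    rw [Nat.mod_add_div] at h1
    refine h1.trans ?_
    have h2 : β ^ τ = β ^ (τ % n) * (1 - ε) ^ (τ / n) := by
      rw [← hβn, ← pow_mul, ← pow_add, Nat.mod_add_div]
    have h3 : 1 - ε ≤ β ^ (τ % n) := by
      rw [← hβn]
      exact pow_le_pow_of_le_one hβ0.le hβ1.le (Nat.mod_lt _ hn).le
    have h4 : 0 ≤ (1 - ε) ^ (τ / n) := pow_nonneg (by linarith) _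
    rw [h2, div_mul_eq_mul_div, le_div_iff₀ (by linarith)]
    nlinarith

lemma IsGeometricMixing.exists_l1Dist_le {P : Matrix S S ℝ} {μ : S → ℝ} {C β : ℝ}
    (h : IsGeometricMixing P μ C β) {ε : ℝ} (hε : 0 < ε) :
    ∃ τ, ∀ s, l1Dist P μ τ s ≤ ε := by
  obtain ⟨hC, hβ0, hβ1, h⟩ := h
  obtain ⟨τ, hτ⟩ := exists_pow_lt_of_lt_one (div_pos hε (by linarith : 0 < C)) hβ1
  refine ⟨τ, fun s => (h τ s).trans ?_⟩
  rw [lt_div_iff₀ (by linarith)] at hτ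
  linarith

/-- Geometric mixing makes the set of admissible times nonempty, so the infimum is attained and is
not the default `0`. -/
lemma IsGeometricMixing.l1Dist_mixingTime_le {P : Matrix S S ℝ} {μ : S → ℝ} {C β : ℝ}
    (h : IsGeometricMixing P μ C β) {ε : ℝ} (hε : 0 < ε) (s : S) :
    l1Dist P μ (mixingTime P μ ε) s ≤ ε :=
  Nat.sInf_mem (s := {τ : ℕ | ∀ s, l1Dist P μ τ s ≤ ε}) (h.exists_l1Dist_le hε) s

end Stochastic

/-! ### The Dirichlet form and the condition number. -/

lemma mulVec_eq_inner_feature {S : Type*} {d : ℕ} (Φ : Matrix S (Fin d) ℝ)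
    (x : EuclideanSpace ℝ (Fin d)) (s : S) :
    (Φ *ᵥ x.ofLp) s = inner ℝ (feature Φ s) x := by
  simp [Matrix.mulVec, dotProduct, feature, PiLp.inner_apply, mul_comm]

section ConditionNumber

variable {S : Type*} [Fintype S] {d : ℕ}

lemma dirichletSq_nonneg {P : Matrix S S ℝ} (hP : IsStochastic P) {μ : S → ℝ}
    (hμ : IsStationary P μ) (f : S → ℝ) : 0 ≤ dirichletSq P μ f :=
  mul_nonneg (by norm_num) (Finset.sum_nonneg fun s _ => Finset.sum_nonneg fun s' _ =>
    mul_nonneg (mul_nonneg (hμ.1.1 s) ((hP s).1 s')) (sq_nonneg _))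

/-- The Dirichlet form is `⟨f, (I - P) f⟩` in `L²(μ)`. -/
lemma dirichletSq_eq {P : Matrix S S ℝ} (hP : IsStochastic P) {μ : S → ℝ}
    (hμ : IsStationary P μ) (f : S → ℝ) :
    dirichletSq P μ f = ∑ s, ∑ s', μ s * P s s' * (f s * (f s - f s')) := by
  have h1 : ∑ s, ∑ s', μ s * P s s' * f s ^ 2 = ∑ s, μ s * f s ^ 2 := by
    refine Finset.sum_congr rfl fun s _ => ?_
    rw [← Finset.sum_mul, ← Finset.mul_sum, (hP s).2, mul_one]
  have h2 : ∑ s, ∑ s', μ s * P s s' * f s' ^ 2 = ∑ s, μ s * f s ^ 2 := by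
    rw [Finset.sum_comm]
    refine Finset.sum_congr rfl fun s _ => ?_
    rw [← Finset.sum_mul]
    congr 1
    exact congrFun hμ.2 s
  -- `(a - b)² = 2a(a - b) + b² - a²`, and the last two terms cancel on average by stationarity.
  have h3 : ∑ s, ∑ s', μ s * P s s' * (f s - f s') ^ 2
      = 2 * (∑ s, ∑ s', μ s * P s s' * (f s * (f s - f s')))
        + (∑ s, ∑ s', μ s * P s s' * f s' ^ 2) - ∑ s, ∑ s', μ s * P s s' * f s ^ 2 := by
    simp_rw [Finset.mul_sum, ← Finset.sum_add_distrib, ← Finset.sum_sub_distrib]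
    refine Finset.sum_congr rfl fun s _ => Finset.sum_congr rfl fun s' _ => ?_
    ring
  rw [dirichletSq, h3, h1, h2]
  ring

lemma dirichletSq_le {P : Matrix S S ℝ} (hP : IsStochastic P) {μ : S → ℝ}
    (hμ : IsStationary P μ) {f : S → ℝ} (hf : ∀ s, |f s| ≤ 1) : dirichletSq P μ f ≤ 2 := by
  have h : ∑ s, ∑ s', μ s * P s s' * (f s - f s') ^ 2 ≤ ∑ s, ∑ s', μ s * P s s' * 4 := by
    refine Finset.sum_le_sum fun s _ => Finset.sum_le_sum fun s' _ =>
      mul_le_mul_of_nonneg_left ?_ (mul_nonneg (hμ.1.1 s) ((hP s).1 s'))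
    have h1 := abs_le.1 (hf s)
    have h2 := abs_le.1 (hf s')
    nlinarith
  have h4 : ∑ s, ∑ s', μ s * P s s' * 4 = 4 := by
    simp_rw [← Finset.sum_mul, ← Finset.mul_sum, (hP _).2, mul_one, hμ.1.2, one_mul]
  rw [dirichletSq]
  linarith

lemma bddBelow_conditionNumber {P : Matrix S S ℝ} (hP : IsStochastic P) {μ : S → ℝ}
    (hμ : IsStationary P μ) (Φ : Matrix S (Fin d) ℝ) :
    BddBelow (Set.range fun x : Metric.sphere (0 : EuclideanSpace ℝ (Fin d)) 1 =>
      dirichletSq P μ (Φ *ᵥ x.1.ofLp) + (μ ⬝ᵥ (Φ *ᵥ x.1.ofLp)) ^ 2) :=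
  ⟨0, by
    rintro _ ⟨x, rfl⟩
    exact add_nonneg (dirichletSq_nonneg hP hμ _) (sq_nonneg _)⟩

/-- Both terms are homogeneous of degree two, so the infimum over the sphere controls every vector.
-/
lemma conditionNumber_mul_sq_le {P : Matrix S S ℝ} (hP : IsStochastic P) {μ : S → ℝ}
    (hμ : IsStationary P μ) (Φ : Matrix S (Fin d) ℝ) (x : EuclideanSpace ℝ (Fin d)) :
    conditionNumber P μ Φ * ‖x‖ ^ 2
      ≤ dirichletSq P μ (Φ *ᵥ x.ofLp) + (μ ⬝ᵥ (Φ *ᵥ x.ofLp)) ^ 2 := by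
  rcases eq_or_ne x 0 with rfl | hx
  · simpa using dirichletSq_nonneg hP hμ 0
  have hn : ‖x‖ ≠ 0 := norm_ne_zero_iff.2 hx
  have hmem : ‖x‖⁻¹ • x ∈ Metric.sphere (0 : EuclideanSpace ℝ (Fin d)) 1 := by
    simp [norm_smul, hn]
  have h := ciInf_le (bddBelow_conditionNumber hP hμ Φ) ⟨‖x‖⁻¹ • x, hmem⟩
  have hs : dirichletSq P μ (Φ *ᵥ (‖x‖⁻¹ • x).ofLp) + (μ ⬝ᵥ (Φ *ᵥ (‖x‖⁻¹ • x).ofLp)) ^ 2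
      = (‖x‖⁻¹) ^ 2 * (dirichletSq P μ (Φ *ᵥ x.ofLp) + (μ ⬝ᵥ (Φ *ᵥ x.ofLp)) ^ 2) := by
    have hd : ∀ (c : ℝ) (f : S → ℝ), dirichletSq P μ (c • f) = c ^ 2 * dirichletSq P μ f := by
      intro c f
      simp only [dirichletSq, Finset.mul_sum, Pi.smul_apply, smul_eq_mul]
      refine Finset.sum_congr rfl fun s _ => Finset.sum_congr rfl fun s' _ => ?_
      ring
    rw [WithLp.ofLp_smul, Matrix.mulVec_smul, hd, dotProduct_smul, smul_eq_mul]
    ring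
  change conditionNumber P μ Φ ≤ _ at h
  simp only [hs] at h
  calc conditionNumber P μ Φ * ‖x‖ ^ 2 ≤ _ := mul_le_mul_of_nonneg_right h (sq_nonneg _)
    _ = _ := by field_simp

/-- Test on a coordinate vector: its image is bounded by `1`, so the energy is at most `2` and the
squared mean at most `1`. -/
lemma conditionNumber_le_three {P : Matrix S S ℝ} (hP : IsStochastic P) {μ : S → ℝ}
    (hμ : IsStationary P μ) {Φ : Matrix S (Fin d) ℝ} (hΦ : ∀ s, ‖feature Φ s‖ ≤ 1)
    (hd : 0 < d) : conditionNumber P μ Φ ≤ 3 := by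
  set x : EuclideanSpace ℝ (Fin d) := EuclideanSpace.single ⟨0, hd⟩ 1 with hx
  have hxn : ‖x‖ = 1 := by simp [hx]
  have h := conditionNumber_mul_sq_le hP hμ Φ x
  have hf : ∀ s, |(Φ *ᵥ x.ofLp) s| ≤ 1 := by
    intro s
    rw [mulVec_eq_inner_feature]
    refine (abs_real_inner_le_norm _ _).trans ?_
    rw [hxn, mul_one]; exact hΦ s
  have h1 : |μ ⬝ᵥ (Φ *ᵥ x.ofLp)| ≤ 1 := by
    calc |μ ⬝ᵥ (Φ *ᵥ x.ofLp)| ≤ ∑ s, |μ s * (Φ *ᵥ x.ofLp) s| := Finset.abs_sum_le_sum_abs _ _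
      _ ≤ ∑ s, μ s := by
          refine Finset.sum_le_sum fun s _ => ?_
          rw [abs_mul, abs_of_nonneg (hμ.1.1 s)]
          exact mul_le_of_le_one_right (hμ.1.1 s) (hf s)
      _ = 1 := hμ.1.2
  have h2 := dirichletSq_le hP hμ hf
  have h3 := (sq_le_one_iff_abs_le_one _).2 h1
  rw [hxn] at h
  linarith

/-- As `μ` is positive, zero energy forbids any change of `f` along a transition of positive
probability, and primitivity links all states by such transitions. -/
lemma eq_of_dirichletSq_eq_zero [DecidableEq S] {P : Matrix S S ℝ} (hP : IsStochastic P)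
    {μ : S → ℝ} (hμ : IsStationary P μ) (hprim : P.IsPrimitive) {f : S → ℝ}
    (hf : dirichletSq P μ f = 0) (i j : S) : f i = f j := by
  have h1 : ∀ s s', 0 < P s s' → f s = f s' := by
    intro s s' hs
    have h0 : ∑ s, ∑ s', μ s * P s s' * (f s - f s') ^ 2 = 0 := by
      rw [dirichletSq] at hf; linarith
    have hnn : ∀ s s', 0 ≤ μ s * P s s' * (f s - f s') ^ 2 := fun s s' =>
      mul_nonneg (mul_nonneg (hμ.1.1 s) ((hP s).1 s')) (sq_nonneg _)
    have h2 := (Finset.sum_eq_zero_iff_of_nonneg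
      (fun s _ => Finset.sum_nonneg fun s' _ => hnn s s')).1 h0 s (Finset.mem_univ _)
    have h3 := (Finset.sum_eq_zero_iff_of_nonneg (fun s' _ => hnn s s')).1 h2 s'
      (Finset.mem_univ _)
    have h4 : (f s - f s') ^ 2 = 0 :=
      (mul_eq_zero.1 h3).resolve_left (mul_pos (hμ.pos hprim s) hs).ne'
    exact sub_eq_zero.1 (pow_eq_zero_iff two_ne_zero |>.1 h4)
  have h2 : ∀ (n : ℕ) (s s' : S), 0 < (P ^ n) s s' → f s = f s' := by
    intro n
    induction n with
    | zero =>
      intro s s' h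
      rw [pow_zero, Matrix.one_apply] at h
      split_ifs at h with he
      · rw [he]
      · exact absurd h (lt_irrefl _)
    | succ n ih =>
      intro s s' h
      rw [pow_succ, Matrix.mul_apply] at h
      obtain ⟨u, -, hu⟩ := Finset.exists_ne_zero_of_sum_ne_zero h.ne'
      have hu' := mul_ne_zero_iff.1 hu
      exact (ih s u (lt_of_le_of_ne ((hP.pow n s).1 u) hu'.1.symm)).trans
        (h1 u s' (lt_of_le_of_ne ((hP u).1 s') hu'.2.symm))
  obtain ⟨k, -, hk⟩ := hprim.exists_pos_pow
  exact h2 k i j (hk i j)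

/-- By compactness the infimum is attained. A zero value would give a constant function of mean
zero, that is `Φ x = 0`, against the independence of the columns. -/
lemma conditionNumber_pos [DecidableEq S] {P : Matrix S S ℝ} (hP : IsStochastic P)
    {μ : S → ℝ} (hμ : IsStationary P μ) (hprim : P.IsPrimitive) {Φ : Matrix S (Fin d) ℝ}
    (hΦ : LinearIndependent ℝ Φ.col) (hd : 0 < d) : 0 < conditionNumber P μ Φ := by
  have : Nonempty (Fin d) := ⟨⟨0, hd⟩⟩
  set q : EuclideanSpace ℝ (Fin d) → ℝ := fun x =>
    dirichletSq P μ (Φ *ᵥ x.ofLp) + (μ ⬝ᵥ (Φ *ᵥ x.ofLp)) ^ 2 with hq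
  have hcont : Continuous q := by
    simp only [hq, dirichletSq, dotProduct, mulVec_eq_inner_feature]
    fun_prop
  have hne : (Metric.sphere (0 : EuclideanSpace ℝ (Fin d)) 1).Nonempty :=
    NormedSpace.sphere_nonempty.2 zero_le_one
  obtain ⟨x, hx, hmin⟩ := (isCompact_sphere (0 : EuclideanSpace ℝ (Fin d)) 1).exists_isMinOn hne
    hcont.continuousOn
  have hx0 : x ≠ 0 := by
    rintro rfl; simp at hx
  have hpos : 0 < q x := by
    have hnn : 0 ≤ dirichletSq P μ (Φ *ᵥ x.ofLp) := dirichletSq_nonneg hP hμ _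
    refine lt_of_le_of_ne (add_nonneg hnn (sq_nonneg _)) fun h0 => hx0 ?_
    have hD : dirichletSq P μ (Φ *ᵥ x.ofLp) = 0 := by
      have := sq_nonneg (μ ⬝ᵥ (Φ *ᵥ x.ofLp))
      simp only [hq] at h0; linarith
    have hm : μ ⬝ᵥ (Φ *ᵥ x.ofLp) = 0 := by
      simp only [hq, hD, zero_add] at h0
      exact pow_eq_zero_iff two_ne_zero |>.1 h0.symm
    have hconst := eq_of_dirichletSq_eq_zero hP hμ hprim hD
    have hzero : Φ *ᵥ x.ofLp = 0 := by
      funext s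
      have : μ ⬝ᵥ (Φ *ᵥ x.ofLp) = (Φ *ᵥ x.ofLp) s := by
        simp_rw [dotProduct, fun i => hconst i s, ← Finset.sum_mul, hμ.1.2, one_mul]
      rw [← this, hm]; rfl
    have hinj := Matrix.mulVec_injective_iff.2 hΦ
    have : x.ofLp = 0 := hinj (by rw [hzero, Matrix.mulVec_zero])
    ext i
    exact congrFun this i
  have : Nonempty (Metric.sphere (0 : EuclideanSpace ℝ (Fin d)) 1) := hne.to_subtype
  exact hpos.trans_le (le_ciInf fun y => hmin y.2)

end ConditionNumber

/-! ### Lipschitz and growth bounds for the update direction. -/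

section Update

variable {S : Type*} {d : ℕ}

/-- The update direction `f(s, ŝ, θ) + g(s, s', θ)` for a triple `(s, s', ŝ)`. -/
def update (R : S → ℝ) (Φ : Matrix S (Fin d) ℝ) (x : S × S × S)
    (θ : EuclideanSpace ℝ (Fin d)) : EuclideanSpace ℝ (Fin d) :=
  fUpdate R Φ x.1 x.2.2 θ + gUpdate R Φ x.1 x.2.1 θ

lemma update_sub (R : S → ℝ) (Φ : Matrix S (Fin d) ℝ) (x : S × S × S)
    (θ θ' : EuclideanSpace ℝ (Fin d)) :
    update R Φ x θ - update R Φ x θ'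
      = -(inner ℝ (feature Φ x.1) (θ - θ') • feature Φ x.2.2)
        + (inner ℝ (feature Φ x.2.1) (θ - θ') - inner ℝ (feature Φ x.1) (θ - θ'))
          • feature Φ x.1 := by
  simp only [update, fUpdate, gUpdate, inner_sub_right]
  module

lemma abs_inner_feature_le {Φ : Matrix S (Fin d) ℝ} (hΦ : ∀ s, ‖feature Φ s‖ ≤ 1) (s : S)
    (θ : EuclideanSpace ℝ (Fin d)) : |inner ℝ (feature Φ s) θ| ≤ ‖θ‖ :=
  (abs_real_inner_le_norm _ _).trans (mul_le_of_le_one_left (norm_nonneg _) (hΦ s))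

lemma norm_smul_feature_le {Φ : Matrix S (Fin d) ℝ} (hΦ : ∀ s, ‖feature Φ s‖ ≤ 1) (s : S)
    (c : ℝ) : ‖c • feature Φ s‖ ≤ |c| := by
  rw [norm_smul, Real.norm_eq_abs]
  exact mul_le_of_le_one_right (abs_nonneg _) (hΦ s)

lemma norm_update_sub_le {R : S → ℝ} {Φ : Matrix S (Fin d) ℝ} (hΦ : ∀ s, ‖feature Φ s‖ ≤ 1)
    (x : S × S × S) (θ θ' : EuclideanSpace ℝ (Fin d)) :
    ‖update R Φ x θ - update R Φ x θ'‖ ≤ 3 * ‖θ - θ'‖ := by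
  rw [update_sub]
  refine (norm_add_le _ _).trans ?_
  rw [norm_neg]
  have h1 := norm_smul_feature_le hΦ x.2.2 (inner ℝ (feature Φ x.1) (θ - θ'))
  have h2 := norm_smul_feature_le hΦ x.1
    (inner ℝ (feature Φ x.2.1) (θ - θ') - inner ℝ (feature Φ x.1) (θ - θ'))
  have h3 := abs_sub (inner ℝ (feature Φ x.2.1) (θ - θ')) (inner ℝ (feature Φ x.1) (θ - θ'))
  have h4 := abs_inner_feature_le hΦ x.1 (θ - θ')
  have h5 := abs_inner_feature_le hΦ x.2.1 (θ - θ')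
  linarith

/-- The Lipschitz bound plus the size at a reference point, later `θ*`: the two residuals at `θ'`
total at most `2r + 3‖θ'‖`. -/
lemma norm_update_le {R : S → ℝ} {r : ℝ} (hR : ∀ s, |R s| ≤ r) {Φ : Matrix S (Fin d) ℝ}
    (hΦ : ∀ s, ‖feature Φ s‖ ≤ 1) (x : S × S × S) (θ θ' : EuclideanSpace ℝ (Fin d)) :
    ‖update R Φ x θ‖ ≤ 3 * (‖θ - θ'‖ + (r + ‖θ'‖)) := by
  have h0 : ‖update R Φ x θ'‖ ≤ 3 * (r + ‖θ'‖) := by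
    have hr : 0 ≤ r := (abs_nonneg _).trans (hR x.1)
    refine (norm_add_le _ _).trans ?_
    rw [fUpdate, gUpdate, norm_neg]
    have h1 := norm_smul_feature_le hΦ x.2.2 (R x.1 + inner ℝ (feature Φ x.1) θ')
    have h2 := norm_smul_feature_le hΦ x.1
      (R x.1 + inner ℝ (feature Φ x.2.1) θ' - inner ℝ (feature Φ x.1) θ')
    have h3 := abs_add_le (R x.1) (inner ℝ (feature Φ x.1) θ')
    have h4 := abs_sub (R x.1 + inner ℝ (feature Φ x.2.1) θ') (inner ℝ (feature Φ x.1) θ')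
    have h5 := abs_add_le (R x.1) (inner ℝ (feature Φ x.2.1) θ')
    have h6 := abs_inner_feature_le hΦ x.1 θ'
    have h7 := abs_inner_feature_le hΦ x.2.1 θ'
    have h8 := hR x.1
    linarith
  have h1 := norm_update_sub_le (R := R) hΦ x θ θ'
  have h2 := norm_sub_norm_le (update R Φ x θ) (update R Φ x θ')
  linarith

end Update

/-! ### The stationary mean update: drift and fixed point. -/

section MeanUpdate

variable {S : Type*} [Fintype S] {d : ℕ}

/-- The law of a triple `(s, s', ŝ)` with `s ∼ p`, `s' ∼ P(· ∣ s)` and, independently, `ŝ ∼ q`. -/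
def tripleLaw (P : Matrix S S ℝ) (p q : S → ℝ) (x : S × S × S) : ℝ :=
  p x.1 * P x.1 x.2.1 * q x.2.2

lemma tripleLaw_nonneg {P : Matrix S S ℝ} (hP : IsStochastic P) {p q : S → ℝ}
    (hp : p ∈ stdSimplex ℝ S) (hq : q ∈ stdSimplex ℝ S) (x : S × S × S) :
    0 ≤ tripleLaw P p q x :=
  mul_nonneg (mul_nonneg (hp.1 _) ((hP _).1 _)) (hq.1 _)

lemma sum_tripleLaw_mul {P : Matrix S S ℝ} (p q : S → ℝ) (u : S → S → ℝ) (v : S → ℝ) :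
    ∑ x, tripleLaw P p q x * (u x.1 x.2.1 * v x.2.2)
      = (∑ a, ∑ a', p a * P a a' * u a a') * ∑ b, q b * v b := by
  simp only [tripleLaw, Fintype.sum_prod_type]
  rw [Finset.sum_mul]
  refine Finset.sum_congr rfl fun a _ => ?_
  rw [Finset.sum_mul]
  refine Finset.sum_congr rfl fun a' _ => ?_
  rw [Finset.mul_sum]
  refine Finset.sum_congr rfl fun b _ => ?_
  ring

lemma sum_tripleLaw {P : Matrix S S ℝ} (hP : IsStochastic P) {p q : S → ℝ}
    (hp : p ∈ stdSimplex ℝ S) (hq : q ∈ stdSimplex ℝ S) : ∑ x, tripleLaw P p q x = 1 := by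
  have h := sum_tripleLaw_mul (P := P) p q (fun _ _ => 1) (fun _ => 1)
  simp_rw [mul_one, ← Finset.mul_sum, (hP _).2, mul_one] at h
  rw [h, hp.2, hq.2, mul_one]

/-- Replace `p` by `μ`, then `q` by `μ`; each exchange integrates out the other factors, which have
mass one. -/
lemma sum_abs_tripleLaw_sub_le {P : Matrix S S ℝ} (hP : IsStochastic P) {p q μ : S → ℝ}
    (hq : q ∈ stdSimplex ℝ S) (hμ : μ ∈ stdSimplex ℝ S) :
    ∑ x, |tripleLaw P p q x - tripleLaw P μ μ x|
      ≤ (∑ s, |p s - μ s|) + ∑ s, |q s - μ s| := by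
  have h1 := sum_tripleLaw_mul (P := P) (fun s => |p s - μ s|) q (fun _ _ => 1) (fun _ => 1)
  have h2 := sum_tripleLaw_mul (P := P) μ (fun s => |q s - μ s|) (fun _ _ => 1) (fun _ => 1)
  simp_rw [mul_one, ← Finset.mul_sum, (hP _).2, mul_one] at h1 h2
  rw [hq.2, mul_one] at h1
  rw [hμ.2, one_mul] at h2
  rw [← h1, ← h2, ← Finset.sum_add_distrib]
  refine Finset.sum_le_sum fun x _ => ?_
  have h3 : tripleLaw P p q x - tripleLaw P μ μ x
      = (p x.1 - μ x.1) * P x.1 x.2.1 * q x.2.2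
        + μ x.1 * P x.1 x.2.1 * (q x.2.2 - μ x.2.2) := by
    simp only [tripleLaw]; ring
  rw [h3]
  refine (abs_add_le _ _).trans (le_of_eq ?_)
  simp only [tripleLaw, abs_mul, abs_of_nonneg ((hP x.1).1 x.2.1), abs_of_nonneg (hq.1 x.2.2),
    abs_of_nonneg (hμ.1 x.1)]

/-- A function that is centred under the stationary law has a small mean under a law close to
stationarity. -/
lemma abs_sum_tripleLaw_mul_le {P : Matrix S S ℝ} (hP : IsStochastic P) {p q μ : S → ℝ}
    (hq : q ∈ stdSimplex ℝ S) (hμ : μ ∈ stdSimplex ℝ S) {h : S × S × S → ℝ} {m c ε : ℝ}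
    (hmean : ∑ x, tripleLaw P μ μ x * h x = m) (hm : ∑ x, tripleLaw P p q x = 1)
    (hc : ∀ x, |h x| ≤ c) (hp' : ∑ s, |p s - μ s| ≤ ε) (hq' : ∑ s, |q s - μ s| ≤ ε) :
    |∑ x, tripleLaw P p q x * (h x - m)| ≤ 2 * ε * c := by
  -- Rewriting `m` as the stationary mean leaves a difference of laws tested on `h`, so the sup
  -- bound on `h` suffices.
  have h1 : ∑ x, tripleLaw P p q x * (h x - m)
      = ∑ x, (tripleLaw P p q x - tripleLaw P μ μ x) * h x := by
    simp_rw [mul_sub, sub_mul, Finset.sum_sub_distrib, ← Finset.sum_mul, hm, hmean, one_mul]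
  obtain ⟨s⟩ : Nonempty S := by
    by_contra hne
    rw [not_nonempty_iff] at hne
    have := hμ.2
    simp at this
  have hc0 : 0 ≤ c := (abs_nonneg _).trans (hc (s, s, s))
  rw [h1]
  calc |∑ x, (tripleLaw P p q x - tripleLaw P μ μ x) * h x|
      ≤ ∑ x, |(tripleLaw P p q x - tripleLaw P μ μ x) * h x| := Finset.abs_sum_le_sum_abs _ _
    _ ≤ ∑ x, |tripleLaw P p q x - tripleLaw P μ μ x| * c := by
        refine Finset.sum_le_sum fun x _ => ?_
        rw [abs_mul]
        exact mul_le_mul_of_nonneg_left (hc x) (abs_nonneg _)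
    _ = (∑ x, |tripleLaw P p q x - tripleLaw P μ μ x|) * c := by rw [Finset.sum_mul]
    _ ≤ 2 * ε * c := by
        refine mul_le_mul_of_nonneg_right ?_ hc0
        have := sum_abs_tripleLaw_sub_le (p := p) hP hq hμ
        linarith

/-- The mean of the update direction under stationarity. -/
def meanUpdate (P : Matrix S S ℝ) (μ R : S → ℝ) (Φ : Matrix S (Fin d) ℝ)
    (θ : EuclideanSpace ℝ (Fin d)) : EuclideanSpace ℝ (Fin d) :=
  ∑ x, tripleLaw P μ μ x • update R Φ x θ

lemma norm_meanUpdate_sub_le {P : Matrix S S ℝ} (hP : IsStochastic P) {μ : S → ℝ}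
    (hμ : IsStationary P μ) {R : S → ℝ} {Φ : Matrix S (Fin d) ℝ}
    (hΦ : ∀ s, ‖feature Φ s‖ ≤ 1) (θ θ' : EuclideanSpace ℝ (Fin d)) :
    ‖meanUpdate P μ R Φ θ - meanUpdate P μ R Φ θ'‖ ≤ 3 * ‖θ - θ'‖ := by
  simp only [meanUpdate, ← Finset.sum_sub_distrib, ← smul_sub]
  refine (norm_sum_le _ _).trans ?_
  calc ∑ x, ‖tripleLaw P μ μ x • (update R Φ x θ - update R Φ x θ')‖
      ≤ ∑ x, tripleLaw P μ μ x * (3 * ‖θ - θ'‖) := by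
        refine Finset.sum_le_sum fun x _ => ?_
        have h := tripleLaw_nonneg hP hμ.1 hμ.1 x
        rw [norm_smul, Real.norm_eq_abs, abs_of_nonneg h]
        exact mul_le_mul_of_nonneg_left (norm_update_sub_le hΦ x θ θ') h
    _ = 3 * ‖θ - θ'‖ := by rw [← Finset.sum_mul, sum_tripleLaw hP hμ.1 hμ.1, one_mul]

/-- The `fUpdate` part factors over the independent states into minus a squared mean; the `gUpdate`
part is `-⟨f, (I - P) f⟩` in `L²(μ)`, minus the Dirichlet energy. -/
lemma inner_meanUpdate_sub {P : Matrix S S ℝ} (hP : IsStochastic P) {μ : S → ℝ}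
    (hμ : IsStationary P μ) (R : S → ℝ) (Φ : Matrix S (Fin d) ℝ)
    (θ θ' : EuclideanSpace ℝ (Fin d)) :
    inner ℝ (θ - θ') (meanUpdate P μ R Φ θ - meanUpdate P μ R Φ θ')
      = -(dirichletSq P μ (Φ *ᵥ (θ - θ').ofLp) + (μ ⬝ᵥ (Φ *ᵥ (θ - θ').ofLp)) ^ 2) := by
  set z := θ - θ' with hz
  set f : S → ℝ := Φ *ᵥ z.ofLp with hf
  have hfi : ∀ s, inner ℝ (feature Φ s) z = f s := fun s => (mulVec_eq_inner_feature Φ z s).symm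
  have h1 : ∀ x : S × S × S, inner ℝ z (update R Φ x θ - update R Φ x θ')
      = f x.1 * (-f x.2.2) + (-(f x.1 * (f x.1 - f x.2.1))) * 1 := by
    intro x
    rw [update_sub, ← hz, inner_add_right, inner_neg_right, inner_smul_right, inner_smul_right,
      hfi, hfi, real_inner_comm, hfi, real_inner_comm, hfi]
    ring
  simp only [meanUpdate, ← Finset.sum_sub_distrib, ← smul_sub, inner_sum, inner_smul_right, h1]
  simp_rw [mul_add, Finset.sum_add_distrib]
  rw [sum_tripleLaw_mul μ μ (fun a _ => f a) (fun b => -f b),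
    sum_tripleLaw_mul μ μ (fun a a' => -(f a * (f a - f a'))) (fun _ => 1),
    dirichletSq_eq hP hμ]
  simp_rw [← Finset.sum_mul, ← Finset.mul_sum, (hP _).2, mul_one, hμ.1.2, mul_neg,
    Finset.sum_neg_distrib, dotProduct]
  ring

/-- Since `μᵀ P f = μᵀ f` for `f = Φ θ`, the mean update equals `Φᵀ D Π R - Φᵀ D (I - Π P) f`, the
residual of the fixed point equation. -/
lemma meanUpdate_eq_zero [DecidableEq S] {P : Matrix S S ℝ} (hP : IsStochastic P) {μ : S → ℝ}
    (hμ : IsStationary P μ) {R : S → ℝ} {Φ : Matrix S (Fin d) ℝ}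
    {θ : EuclideanSpace ℝ (Fin d)} (hθ : IsFixedPoint P μ R Φ θ) :
    meanUpdate P μ R Φ θ = 0 := by
  set f : S → ℝ := Φ *ᵥ θ.ofLp with hf
  have hfi : ∀ s, inner ℝ (feature Φ s) θ = f s := fun s => (mulVec_eq_inner_feature Φ θ s).symm
  have hcent : ∀ (v : S → ℝ) (a : S), (centering μ *ᵥ v) a = v a - μ ⬝ᵥ v := by
    intro v a
    simp [centering, Matrix.sub_mulVec, Matrix.vecMulVec_mulVec]
  ext i
  have h1 : ∀ x : S × S × S, (update R Φ x θ) i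
      = (R x.1 + f x.1) * (-Φ x.2.2 i) + ((R x.1 + f x.2.1 - f x.1) * Φ x.1 i) * 1 := by
    intro x
    simp only [update, fUpdate, gUpdate, hfi, PiLp.add_apply, PiLp.neg_apply,
      PiLp.smul_apply, smul_eq_mul]
    simp only [feature]
    ring
  have h2 := congrFun hθ i
  rw [← Matrix.mulVec_mulVec, ← hf, ← Matrix.mulVec_mulVec, ← Matrix.mulVec_mulVec,
    ← Matrix.mulVec_mulVec, ← Matrix.mulVec_mulVec, Matrix.sub_mulVec, Matrix.one_mulVec,
    ← Matrix.mulVec_mulVec] at h2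
  have h3 : μ ⬝ᵥ (P *ᵥ f) = μ ⬝ᵥ f := by rw [Matrix.dotProduct_mulVec, hμ.2]
  have hdiag : ∀ v : S → ℝ, (Φᵀ *ᵥ (diagonal μ *ᵥ v)) i = ∑ a, Φ a i * (μ a * v a) := by
    intro v
    simp only [Matrix.mulVec, dotProduct, Matrix.diagonal_apply, ite_mul, zero_mul,
      Finset.sum_ite_eq, Finset.mem_univ, if_true, Matrix.transpose_apply]
  rw [hdiag, hdiag] at h2
  simp only [Pi.sub_apply, hcent, h3] at h2
  have h4 : ∀ a, ∑ a', μ a * P a a' * ((R a + f a' - f a) * Φ a i)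
      = Φ a i * (μ a * (R a - f a)) + Φ a i * (μ a * (P *ᵥ f) a) := by
    intro a
    have : ∀ a', μ a * P a a' * ((R a + f a' - f a) * Φ a i)
        = P a a' * (Φ a i * (μ a * (R a - f a))) + Φ a i * μ a * (P a a' * f a') := by
      intro a'; ring
    simp_rw [this, Finset.sum_add_distrib, ← Finset.sum_mul, ← Finset.mul_sum, (hP a).2, one_mul,
      mul_assoc]
    rfl
  rw [meanUpdate, WithLp.ofLp_sum, Finset.sum_apply]
  simp only [PiLp.smul_apply, smul_eq_mul, h1]
  simp_rw [mul_add, Finset.sum_add_distrib]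
  rw [sum_tripleLaw_mul μ μ (fun a _ => R a + f a) (fun b => -Φ b i),
    sum_tripleLaw_mul μ μ (fun a a' => (R a + f a' - f a) * Φ a i) (fun _ => 1)]
  simp_rw [h4, ← Finset.sum_mul, ← Finset.mul_sum, (hP _).2, mul_one, hμ.1.2, mul_one,
    mul_neg, Finset.sum_neg_distrib]
  have h5 : ∑ a, μ a * (R a + f a) = μ ⬝ᵥ R + μ ⬝ᵥ f := by
    simp only [dotProduct, ← Finset.sum_add_distrib, mul_add]
  have h6 : ∀ k : ℝ, (∑ b, μ b * Φ b i) * k = ∑ b, Φ b i * (μ b * k) := by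
    intro k
    rw [Finset.sum_mul]
    exact Finset.sum_congr rfl fun b _ => by ring
  rw [h5, mul_neg, mul_comm, h6, ← Finset.sum_neg_distrib, ← Finset.sum_add_distrib]
  rw [← sub_eq_zero, ← Finset.sum_sub_distrib] at h2
  rw [PiLp.zero_apply, ← neg_eq_zero, ← h2, ← Finset.sum_neg_distrib]
  refine Finset.sum_congr rfl fun a _ => ?_
  ring

end MeanUpdate

/-! ### Joint laws of the past and of the delayed states. -/

section Markov

variable {S Ω : Type*}

/-- The path that follows `x` up to time `k` and then stays at `b`. -/
def extendPath (k : ℕ) (x : ℕ → S) (b : S) (i : ℕ) : S := if i ≤ k then x i else b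

lemma forall_le_succ_extendPath {X : ℕ → S} {x : ℕ → S} {k : ℕ} {b : S} :
    (∀ i ≤ k + 1, X i = extendPath k x b i) ↔ (∀ i ≤ k, X i = x i) ∧ X (k + 1) = b := by
  constructor
  · intro h
    refine ⟨fun i hi => ?_, ?_⟩
    · rw [h i (by omega), extendPath, if_pos hi]
    · rw [h (k + 1) le_rfl, extendPath, if_neg (by omega)]
  · rintro ⟨h1, h2⟩ i hi
    rw [extendPath]
    split_ifs with h
    · exact h1 i h
    · rw [show i = k + 1 by omega, h2]

variable [MeasurableSpace S] [MeasurableSingletonClass S] [MeasurableSpace Ω]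

lemma measurableSet_path {X : ℕ → Ω → S} (hX : ∀ t, Measurable (X t)) (k : ℕ) (x : ℕ → S) :
    MeasurableSet {ω | ∀ i ≤ k, X i ω = x i} := by
  have : {ω | ∀ i ≤ k, X i ω = x i} = ⋂ i ∈ Set.Iic k, X i ⁻¹' {x i} := by
    ext ω; simp
  rw [this]
  exact MeasurableSet.biInter (Set.to_countable _) fun i _ => hX i (measurableSet_singleton _)

variable [Fintype S] {Q : Measure Ω} [IsProbabilityMeasure Q]

lemma measureReal_eq_sum_inter {Y : Ω → S} (hY : Measurable Y) {E : Set Ω}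
    (hE : MeasurableSet E) : Q.real E = ∑ b, Q.real (E ∩ {ω | Y ω = b}) := by
  have h : E = ⋃ b ∈ (Finset.univ : Finset S), E ∩ {ω | Y ω = b} := by
    ext ω; simp
  conv_lhs => rw [h]
  refine measureReal_biUnion_finset ?_ fun b _ => hE.inter (hY (measurableSet_singleton b))
  intro b _ b' _ hb
  refine Set.disjoint_left.2 fun ω h1 h2 => hb ?_
  exact h1.2.symm.trans h2.2

variable [DecidableEq S]

/-- The joint law of the path up to time `k` and of the states at times `k + τ`, `k + τ + 1`. -/
lemma IsMarkovChain.measureReal_path_pair {P : Matrix S S ℝ} {X : ℕ → Ω → S}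
    (hX : IsMarkovChain Q P X) (τ k : ℕ) (x : ℕ → S) (a a' : S) :
    Q.real {ω | (∀ i ≤ k, X i ω = x i) ∧ X (k + τ) ω = a ∧ X (k + τ + 1) ω = a'}
      = Q.real {ω | ∀ i ≤ k, X i ω = x i} * ((P ^ τ) (x k) a * P a a') := by
  have hext : ∀ k (x : ℕ → S) b, Q.real {ω | ∀ i ≤ k + 1, X i ω = extendPath k x b i}
      = Q.real {ω | ∀ i ≤ k, X i ω = x i} * P (x k) b := by
    intro k x b
    rw [hX.2]
    congr 1
    · congr 1
      ext ω
      refine forall_congr' fun i => forall_congr' fun hi => ?_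
      rw [extendPath, if_pos hi]
    · simp [extendPath]
  -- The successor step splits on the state at time `k + 1`: the known path grows by one and the
  -- delay shrinks by one.
  induction τ generalizing k x with
  | zero =>
    by_cases ha : x k = a
    · rw [pow_zero, ha, Matrix.one_apply_eq, one_mul, ← ha, ← hext]
      congr 1
      ext ω
      rw [Set.mem_ofPred_eq, Set.mem_ofPred_eq, forall_le_succ_extendPath (X := fun i => X i ω)]
      exact ⟨fun h => ⟨h.1, h.2.2⟩, fun h => ⟨h.1, h.1 k le_rfl, h.2⟩⟩
    · rw [pow_zero, Matrix.one_apply_ne ha, zero_mul, mul_zero]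
      convert measureReal_empty
      rw [Set.eq_empty_iff_forall_notMem]
      rintro ω ⟨h1, h2, -⟩
      exact ha ((h1 k le_rfl).symm.trans h2)
  | succ τ ih =>
    have hE : MeasurableSet
        {ω | (∀ i ≤ k, X i ω = x i) ∧ X (k + (τ + 1)) ω = a ∧ X (k + (τ + 1) + 1) ω = a'} :=
      (measurableSet_path hX.1 k x).inter ((hX.1 _ (measurableSet_singleton a)).inter
        (hX.1 _ (measurableSet_singleton a')))
    rw [measureReal_eq_sum_inter (hX.1 (k + 1)) hE]
    have hb : ∀ b, Q.real ({ω | (∀ i ≤ k, X i ω = x i) ∧ X (k + (τ + 1)) ω = a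
          ∧ X (k + (τ + 1) + 1) ω = a'} ∩ {ω | X (k + 1) ω = b})
        = Q.real {ω | ∀ i ≤ k, X i ω = x i} * P (x k) b * ((P ^ τ) b a * P a a') := by
      intro b
      rw [← hext]
      have h := ih (k + 1) (extendPath k x b)
      rw [show extendPath k x b (k + 1) = b by simp [extendPath]] at h
      rw [← h]
      congr 1
      ext ω
      simp only [Set.mem_inter_iff, Set.mem_ofPred_eq,
        forall_le_succ_extendPath (X := fun i => X i ω),
        show k + 1 + τ = k + (τ + 1) by omega]
      tauto
    simp_rw [hb, pow_succ', Matrix.mul_apply, Finset.sum_mul, Finset.mul_sum]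
    exact Finset.sum_congr rfl fun b _ => by ring

lemma IsMarkovChain.measureReal_path_state {P : Matrix S S ℝ} (hP : IsStochastic P)
    {X : ℕ → Ω → S} (hX : IsMarkovChain Q P X) (τ k : ℕ) (x : ℕ → S) (a : S) :
    Q.real {ω | (∀ i ≤ k, X i ω = x i) ∧ X (k + τ) ω = a}
      = Q.real {ω | ∀ i ≤ k, X i ω = x i} * (P ^ τ) (x k) a := by
  have hE : MeasurableSet {ω | (∀ i ≤ k, X i ω = x i) ∧ X (k + τ) ω = a} :=
    (measurableSet_path hX.1 k x).inter (hX.1 _ (measurableSet_singleton a))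
  rw [measureReal_eq_sum_inter (hX.1 (k + τ + 1)) hE]
  have hb : ∀ b, Q.real ({ω | (∀ i ≤ k, X i ω = x i) ∧ X (k + τ) ω = a}
      ∩ {ω | X (k + τ + 1) ω = b})
      = Q.real {ω | ∀ i ≤ k, X i ω = x i} * (P ^ τ) (x k) a * P a b := by
    intro b
    rw [mul_assoc, ← hX.measureReal_path_pair]
    congr 1
    ext ω
    simp only [Set.mem_inter_iff, Set.mem_ofPred_eq, and_assoc]
  simp_rw [hb, ← Finset.mul_sum, (hP a).2, mul_one]

/-- The joint law of the paths of two independent chains up to time `k` and of the states that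
enter the update at time `k + τ`. -/
lemma measureReal_paths_triple {P : Matrix S S ℝ} (hP : IsStochastic P) {X Y : ℕ → Ω → S}
    (hX : IsMarkovChain Q P X) (hY : IsMarkovChain Q P Y)
    (hind : IndepFun (fun ω t => X t ω) (fun ω t => Y t ω) Q) (τ k : ℕ) (x y : ℕ → S)
    (z : S × S × S) :
    Q.real {ω | ((∀ i ≤ k, X i ω = x i) ∧ ∀ i ≤ k, Y i ω = y i) ∧
        (X (k + τ) ω, X (k + τ + 1) ω, Y (k + τ) ω) = z}
      = Q.real {ω | ∀ i ≤ k, X i ω = x i} * Q.real {ω | ∀ i ≤ k, Y i ω = y i}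
        * tripleLaw P ((P ^ τ) (x k)) ((P ^ τ) (y k)) z := by
  obtain ⟨a, a', b⟩ := z
  have hpi : ∀ t : ℕ, Measurable fun u : ℕ → S => u t := fun t => measurable_pi_apply t
  have hE : MeasurableSet
      {u : ℕ → S | (∀ i ≤ k, u i = x i) ∧ u (k + τ) = a ∧ u (k + τ + 1) = a'} :=
    (measurableSet_path (Ω := ℕ → S) hpi k x).inter
      ((hpi _ (measurableSet_singleton a)).inter (hpi _ (measurableSet_singleton a')))
  have hF : MeasurableSet {u : ℕ → S | (∀ i ≤ k, u i = y i) ∧ u (k + τ) = b} :=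
    (measurableSet_path (Ω := ℕ → S) hpi k y).inter (hpi _ (measurableSet_singleton b))
  have h := congrArg ENNReal.toReal (hind.measure_inter_preimage_eq_mul _ _ hE hF)
  rw [ENNReal.toReal_mul] at h
  have h1 := hX.measureReal_path_pair τ k x a a'
  have h2 := hY.measureReal_path_state hP τ k y b
  have h3 : Q.real {ω | ((∀ i ≤ k, X i ω = x i) ∧ ∀ i ≤ k, Y i ω = y i) ∧
        (X (k + τ) ω, X (k + τ + 1) ω, Y (k + τ) ω) = (a, a', b)}
      = Q.real {ω | (∀ i ≤ k, X i ω = x i) ∧ X (k + τ) ω = a ∧ X (k + τ + 1) ω = a'}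
        * Q.real {ω | (∀ i ≤ k, Y i ω = y i) ∧ Y (k + τ) ω = b} := by
    refine Eq.trans (congrArg Q.real ?_) h
    ext ω
    simp only [Set.mem_inter_iff, Set.mem_ofPred_eq, Set.mem_preimage, Prod.mk.injEq]
    tauto
  rw [h3, h1, h2, tripleLaw]
  ring

end Markov

/-! ### Expectations of adapted functions as finite sums. -/

section Expectation

variable {S Ω : Type*}

/-- A function of two trajectories that depends only on the states up to time `k`. -/
def IsAdapted {E : Type*} (k : ℕ) (F : (ℕ → S) → (ℕ → S) → E) : Prop :=
  ∀ x x' y y' : ℕ → S, (∀ i ≤ k, x i = x' i) → (∀ i ≤ k, y i = y' i) → F x y = F x' y'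

/-- Extension of a finite path by its last state. -/
def frozenPath (k : ℕ) (p : Fin (k + 1) → S) (i : ℕ) : S := p ⟨min i k, by omega⟩

/-- The initial segment of a trajectory. -/
def truncPath (k : ℕ) (x : ℕ → S) (i : Fin (k + 1)) : S := x i

lemma frozenPath_of_le {k : ℕ} (p : Fin (k + 1) → S) {i : ℕ} (hi : i ≤ k) :
    frozenPath k p i = p ⟨i, by omega⟩ := by
  simp [frozenPath, hi]

lemma truncPath_eq_iff {k : ℕ} {x : ℕ → S} {p : Fin (k + 1) → S} :
    truncPath k x = p ↔ ∀ i ≤ k, x i = frozenPath k p i := by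
  constructor
  · rintro rfl i hi
    rw [frozenPath_of_le _ hi]
    rfl
  · intro h
    funext i
    have := h i (by omega)
    rwa [frozenPath_of_le _ (by omega)] at this

lemma IsAdapted.mono {E : Type*} {k l : ℕ} (hkl : k ≤ l) {F : (ℕ → S) → (ℕ → S) → E}
    (hF : IsAdapted k F) : IsAdapted l F := fun x x' y y' hx hy =>
  hF x x' y y' (fun i hi => hx i (hi.trans hkl)) (fun i hi => hy i (hi.trans hkl))

/-- Adapted functions factor through initial segments, which form a finite type; integrability is
then automatic and expectations are finite sums. -/
lemma IsAdapted.eq_frozenPath {E : Type*} {k : ℕ} {F : (ℕ → S) → (ℕ → S) → E}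
    (hF : IsAdapted k F) (x y : ℕ → S) :
    F x y = F (frozenPath k (truncPath k x)) (frozenPath k (truncPath k y)) :=
  hF _ _ _ _ (truncPath_eq_iff.1 rfl) (truncPath_eq_iff.1 rfl)

variable [MeasurableSpace S] [MeasurableSpace Ω]

lemma measurable_truncPath {X : ℕ → Ω → S} (hX : ∀ t, Measurable (X t)) (k : ℕ) :
    Measurable fun ω => truncPath k fun t => X t ω :=
  measurable_pi_lambda _ fun i => hX i

variable [Fintype S] [MeasurableSingletonClass S] {Q : Measure Ω} [IsProbabilityMeasure Q]

lemma integral_comp_finite {Y : Type*} [Fintype Y] [MeasurableSpace Y]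
    [MeasurableSingletonClass Y] {Z : Ω → Y} (hZ : Measurable Z) (g : Y → ℝ) :
    ∫ ω, g (Z ω) ∂Q = ∑ y, Q.real {ω | Z ω = y} * g y := by
  rw [← integral_map (f := g) hZ.aemeasurable
    (measurable_of_finite g).aestronglyMeasurable]
  have : IsProbabilityMeasure (Q.map Z) := Measure.isProbabilityMeasure_map hZ.aemeasurable
  rw [integral_fintype (.of_finite)]
  refine Finset.sum_congr rfl fun y _ => ?_
  rw [map_measureReal_apply hZ (measurableSet_singleton y), smul_eq_mul]
  rfl

lemma integrable_comp_finite {Y : Type*} [Finite Y] [MeasurableSpace Y]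
    [MeasurableSingletonClass Y] {Z : Ω → Y} (hZ : Measurable Z) (g : Y → ℝ) :
    Integrable (fun ω => g (Z ω)) Q := by
  have : IsProbabilityMeasure (Q.map Z) := Measure.isProbabilityMeasure_map hZ.aemeasurable
  exact (Integrable.of_finite (μ := Q.map Z) (f := g)).comp_measurable hZ

lemma IsAdapted.integrable {k : ℕ} {F : (ℕ → S) → (ℕ → S) → ℝ} (hF : IsAdapted k F)
    {X Y : ℕ → Ω → S} (hX : ∀ t, Measurable (X t)) (hY : ∀ t, Measurable (Y t)) :
    Integrable (fun ω => F (fun t => X t ω) fun t => Y t ω) Q := by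
  rw [show (fun ω => F (fun t => X t ω) fun t => Y t ω) = fun ω =>
    F (frozenPath k (truncPath k fun t => X t ω)) (frozenPath k (truncPath k fun t => Y t ω)) from
    funext fun ω => hF.eq_frozenPath _ _]
  exact integrable_comp_finite ((measurable_truncPath hX k).prodMk (measurable_truncPath hY k))
    fun p => F (frozenPath k p.1) (frozenPath k p.2)

variable [DecidableEq S]

/-- Conditioning on both pasts, written as a finite sum in place of a conditional expectation. -/
lemma integral_adapted_triple {P : Matrix S S ℝ} (hP : IsStochastic P) {X Y : ℕ → Ω → S}
    (hX : IsMarkovChain Q P X) (hY : IsMarkovChain Q P Y)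
    (hind : IndepFun (fun ω t => X t ω) (fun ω t => Y t ω) Q) (τ k : ℕ) {E : Type*}
    {F : (ℕ → S) → (ℕ → S) → E} (hF : IsAdapted k F) (H : E → S × S × S → ℝ) :
    ∫ ω, H (F (fun t => X t ω) fun t => Y t ω)
        (X (k + τ) ω, X (k + τ + 1) ω, Y (k + τ) ω) ∂Q
      = ∑ p : (Fin (k + 1) → S) × (Fin (k + 1) → S),
        Q.real {ω | ∀ i ≤ k, X i ω = frozenPath k p.1 i}
          * Q.real {ω | ∀ i ≤ k, Y i ω = frozenPath k p.2 i}
          * ∑ z, tripleLaw P ((P ^ τ) (frozenPath k p.1 k)) ((P ^ τ) (frozenPath k p.2 k)) z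
            * H (F (frozenPath k p.1) (frozenPath k p.2)) z := by
  rw [show (fun ω => H (F (fun t => X t ω) fun t => Y t ω)
      (X (k + τ) ω, X (k + τ + 1) ω, Y (k + τ) ω)) = fun ω =>
      H (F (frozenPath k (truncPath k fun t => X t ω)) (frozenPath k (truncPath k fun t => Y t ω)))
        (X (k + τ) ω, X (k + τ + 1) ω, Y (k + τ) ω) from
    funext fun ω => congrArg (H · _) (hF.eq_frozenPath _ _),
    integral_comp_finite (Y := ((Fin (k + 1) → S) × (Fin (k + 1) → S)) × (S × S × S))
    (Z := fun ω => ((truncPath k fun t => X t ω, truncPath k fun t => Y t ω),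
      (X (k + τ) ω, X (k + τ + 1) ω, Y (k + τ) ω)))
    (((measurable_truncPath hX.1 k).prodMk (measurable_truncPath hY.1 k)).prodMk
      ((hX.1 _).prodMk ((hX.1 _).prodMk (hY.1 _))))
    (fun w => H (F (frozenPath k w.1.1) (frozenPath k w.1.2)) w.2), Fintype.sum_prod_type]
  refine Finset.sum_congr rfl fun p _ => ?_
  rw [Finset.mul_sum]
  refine Finset.sum_congr rfl fun z _ => ?_
  rw [← mul_assoc, ← measureReal_paths_triple hP hX hY hind]
  congr 2
  ext ω
  simp only [Set.mem_ofPred_eq, Prod.ext_iff (x := ((_, _), _)), Prod.ext_iff (x := (_, _)),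
    truncPath_eq_iff]

/-- If, whatever the states `i`, `j` of the chains at time `k`, the mean of `H e` under the law of
the states at time `k + τ` is at most `c e`, then `E[H(F, ·)] ≤ E[c(F)]` for every `F` known at
time `k`. -/
lemma integral_adapted_triple_le {P : Matrix S S ℝ} (hP : IsStochastic P) {X Y : ℕ → Ω → S}
    (hX : IsMarkovChain Q P X) (hY : IsMarkovChain Q P Y)
    (hind : IndepFun (fun ω t => X t ω) (fun ω t => Y t ω) Q) (τ k : ℕ) {E : Type*}
    {F : (ℕ → S) → (ℕ → S) → E} (hF : IsAdapted k F) (H : E → S × S × S → ℝ) (c : E → ℝ)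
    (hH : ∀ e i j, ∑ z, tripleLaw P ((P ^ τ) i) ((P ^ τ) j) z * H e z ≤ c e) :
    ∫ ω, H (F (fun t => X t ω) fun t => Y t ω)
        (X (k + τ) ω, X (k + τ + 1) ω, Y (k + τ) ω) ∂Q
      ≤ ∫ ω, c (F (fun t => X t ω) fun t => Y t ω) ∂Q := by
  have h := integral_adapted_triple hP hX hY hind τ k hF fun e _ => c e
  rw [h, integral_adapted_triple hP hX hY hind τ k hF H]
  refine Finset.sum_le_sum fun p _ => mul_le_mul_of_nonneg_left ?_
    (mul_nonneg measureReal_nonneg measureReal_nonneg)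
  rw [← Finset.sum_mul, sum_tripleLaw hP (hP.pow τ _) (hP.pow τ _), one_mul]
  exact hH _ _ _

end Expectation

/-! ### Pathwise estimates for the iterates. -/

section Iterates

variable {S : Type*} {d : ℕ}

lemma doubleChain_succ (R : S → ℝ) (Φ : Matrix S (Fin d) ℝ) (α : ℕ → ℝ)
    (θ₀ : EuclideanSpace ℝ (Fin d)) (x y : ℕ → S) (t : ℕ) :
    doubleChain R Φ α θ₀ x y (t + 1) = doubleChain R Φ α θ₀ x y t
      + α t • update R Φ (x t, x (t + 1), y t) (doubleChain R Φ α θ₀ x y t) := rfl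

lemma isAdapted_doubleChain (R : S → ℝ) (Φ : Matrix S (Fin d) ℝ) (α : ℕ → ℝ)
    (θ₀ : EuclideanSpace ℝ (Fin d)) (t : ℕ) :
    IsAdapted t fun x y => doubleChain R Φ α θ₀ x y t := by
  intro x x' y y' hx hy
  induction t with
  | zero => rfl
  | succ t ih =>
    have h := ih (fun i hi => hx i (by omega)) (fun i hi => hy i (by omega))
    simp only [doubleChain_succ] at h ⊢
    rw [h, hx t (by omega), hx (t + 1) le_rfl, hy t (by omega)]

lemma norm_doubleChain_succ_sub_le {R : S → ℝ} {r : ℝ} (hR : ∀ s, |R s| ≤ r)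
    {Φ : Matrix S (Fin d) ℝ} (hΦ : ∀ s, ‖feature Φ s‖ ≤ 1) {α : ℝ} (hα : 0 ≤ α)
    (θ₀ θ' : EuclideanSpace ℝ (Fin d)) (x y : ℕ → S) (t : ℕ) :
    ‖doubleChain R Φ (fun _ => α) θ₀ x y (t + 1) - doubleChain R Φ (fun _ => α) θ₀ x y t‖
      ≤ 3 * α * (‖doubleChain R Φ (fun _ => α) θ₀ x y t - θ'‖ + (r + ‖θ'‖)) := by
  rw [doubleChain_succ, add_sub_cancel_left, norm_smul, Real.norm_eq_abs, abs_of_nonneg hα]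
  have h := mul_le_mul_of_nonneg_left (norm_update_le hR hΦ (x t, x (t + 1), y t)
    (doubleChain R Φ (fun _ => α) θ₀ x y t) θ') hα
  linarith

/-- Deterministic growth of the iterates. -/
lemma norm_doubleChain_sub_add_le {R : S → ℝ} {r : ℝ} (hR : ∀ s, |R s| ≤ r)
    {Φ : Matrix S (Fin d) ℝ} (hΦ : ∀ s, ‖feature Φ s‖ ≤ 1) {α : ℝ} (hα : 0 ≤ α)
    (θ₀ θ' : EuclideanSpace ℝ (Fin d)) (x y : ℕ → S) (t : ℕ) :
    ‖doubleChain R Φ (fun _ => α) θ₀ x y t - θ'‖ + (r + ‖θ'‖)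
      ≤ (1 + 3 * α) ^ t * (‖θ₀ - θ'‖ + (r + ‖θ'‖)) := by
  induction t with
  | zero => simp [doubleChain]
  | succ t ih =>
    have h1 := norm_doubleChain_succ_sub_le hR hΦ hα θ₀ θ' x y t
    have h2 := norm_sub_le_norm_sub_add_norm_sub (doubleChain R Φ (fun _ => α) θ₀ x y (t + 1))
      (doubleChain R Φ (fun _ => α) θ₀ x y t) θ'
    calc _ ≤ (1 + 3 * α)
          * (‖doubleChain R Φ (fun _ => α) θ₀ x y t - θ'‖ + (r + ‖θ'‖)) := by linarith
      _ ≤ (1 + 3 * α) * ((1 + 3 * α) ^ t * (‖θ₀ - θ'‖ + (r + ‖θ'‖))) :=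
          mul_le_mul_of_nonneg_left ih (by linarith)
      _ = _ := by ring

/-- Left as a sum over single steps, so that later only second moments of the individual iterates
are needed. -/
lemma norm_doubleChain_add_sub_le {R : S → ℝ} {r : ℝ} (hR : ∀ s, |R s| ≤ r)
    {Φ : Matrix S (Fin d) ℝ} (hΦ : ∀ s, ‖feature Φ s‖ ≤ 1) {α : ℝ} (hα : 0 ≤ α)
    (θ₀ θ' : EuclideanSpace ℝ (Fin d)) (x y : ℕ → S) (k n : ℕ) :
    ‖doubleChain R Φ (fun _ => α) θ₀ x y (k + n) - doubleChain R Φ (fun _ => α) θ₀ x y k‖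
      ≤ ∑ j ∈ Finset.range n,
        3 * α * (‖doubleChain R Φ (fun _ => α) θ₀ x y (k + j) - θ'‖ + (r + ‖θ'‖)) := by
  induction n with
  | zero => simp
  | succ n ih =>
    rw [Finset.sum_range_succ]
    have h1 := norm_doubleChain_succ_sub_le hR hΦ hα θ₀ θ' x y (k + n)
    have h2 := norm_sub_le_norm_sub_add_norm_sub
      (doubleChain R Φ (fun _ => α) θ₀ x y (k + n + 1))
      (doubleChain R Φ (fun _ => α) θ₀ x y (k + n)) (doubleChain R Φ (fun _ => α) θ₀ x y k)
    rw [← add_assoc k n 1]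
    linarith

variable [Fintype S]

/-- The inner product of the error with the noise of the update. -/
def noise (P : Matrix S S ℝ) (μ R : S → ℝ) (Φ : Matrix S (Fin d) ℝ)
    (θstar θ : EuclideanSpace ℝ (Fin d)) (z : S × S × S) : ℝ :=
  inner ℝ (θ - θstar) (update R Φ z θ - meanUpdate P μ R Φ θ)

/-- The noise is quadratic in `θ`: vary the error factor, then the update factor, where update minus
mean is `6`-Lipschitz. -/
lemma noise_sub_le {P : Matrix S S ℝ} (hP : IsStochastic P) {μ : S → ℝ}
    (hμ : IsStationary P μ) {R : S → ℝ} {r : ℝ} (hR : ∀ s, |R s| ≤ r)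
    {Φ : Matrix S (Fin d) ℝ} (hΦ : ∀ s, ‖feature Φ s‖ ≤ 1)
    {θstar : EuclideanSpace ℝ (Fin d)} (hθ : meanUpdate P μ R Φ θstar = 0)
    (θ θ' : EuclideanSpace ℝ (Fin d)) (z : S × S × S) :
    noise P μ R Φ θstar θ z - noise P μ R Φ θstar θ' z
      ≤ ‖θ - θ'‖ * (6 * ‖θ - θstar‖ + 6 * ‖θ' - θstar‖ + 3 * (r + ‖θstar‖)) := by
  have h : noise P μ R Φ θstar θ z - noise P μ R Φ θstar θ' z
      = inner ℝ (θ - θ') (update R Φ z θ - meanUpdate P μ R Φ θ)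
        + inner ℝ (θ' - θstar) ((update R Φ z θ - update R Φ z θ')
          - (meanUpdate P μ R Φ θ - meanUpdate P μ R Φ θ')) := by
    rw [noise, noise, show θ - θstar = (θ - θ') + (θ' - θstar) by abel, inner_add_left,
      add_sub_assoc, ← inner_sub_right]
    congr 2
    abel
  have h1 : ‖update R Φ z θ - meanUpdate P μ R Φ θ‖
      ≤ 6 * ‖θ - θstar‖ + 3 * (r + ‖θstar‖) := by
    have a1 := norm_update_le hR hΦ z θ θstar
    have a2 := norm_meanUpdate_sub_le (R := R) hP hμ hΦ θ θstar
    rw [hθ, sub_zero] at a2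
    have a3 := norm_sub_le (update R Φ z θ) (meanUpdate P μ R Φ θ)
    linarith
  have h2 : ‖(update R Φ z θ - update R Φ z θ')
      - (meanUpdate P μ R Φ θ - meanUpdate P μ R Φ θ')‖ ≤ 6 * ‖θ - θ'‖ := by
    have a1 := norm_update_sub_le (R := R) hΦ z θ θ'
    have a2 := norm_meanUpdate_sub_le (R := R) hP hμ hΦ θ θ'
    have a3 := norm_sub_le (update R Φ z θ - update R Φ z θ')
      (meanUpdate P μ R Φ θ - meanUpdate P μ R Φ θ')
    linarith
  have h3 := (real_inner_le_norm (θ - θ') (update R Φ z θ - meanUpdate P μ R Φ θ)).trans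
    (mul_le_mul_of_nonneg_left h1 (norm_nonneg _))
  have h4 := (real_inner_le_norm (θ' - θstar) ((update R Φ z θ - update R Φ z θ')
    - (meanUpdate P μ R Φ θ - meanUpdate P μ R Φ θ'))).trans
    (mul_le_mul_of_nonneg_left h2 (norm_nonneg _))
  rw [h]
  linarith

/-- One step of the squared error in terms of the noise at an earlier iterate. -/
lemma norm_sq_doubleChain_succ_le {P : Matrix S S ℝ} (hP : IsStochastic P) {μ : S → ℝ}
    (hμ : IsStationary P μ) {R : S → ℝ} {r : ℝ} (hR : ∀ s, |R s| ≤ r)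
    {Φ : Matrix S (Fin d) ℝ} (hΦ : ∀ s, ‖feature Φ s‖ ≤ 1)
    {θstar : EuclideanSpace ℝ (Fin d)} (hθ : meanUpdate P μ R Φ θstar = 0) {α : ℝ} (hα : 0 ≤ α)
    (θ₀ : EuclideanSpace ℝ (Fin d)) (x y : ℕ → S) (k τ : ℕ) :
    ‖doubleChain R Φ (fun _ => α) θ₀ x y (k + τ + 1) - θstar‖ ^ 2
      ≤ (1 - 2 * α * conditionNumber P μ Φ)
          * ‖doubleChain R Φ (fun _ => α) θ₀ x y (k + τ) - θstar‖ ^ 2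
        + 2 * α * noise P μ R Φ θstar (doubleChain R Φ (fun _ => α) θ₀ x y k)
            (x (k + τ), x (k + τ + 1), y (k + τ))
        + α ^ 2 * (∑ j ∈ Finset.range τ,
            (45 * ‖doubleChain R Φ (fun _ => α) θ₀ x y (k + j) - θstar‖ ^ 2
              + 36 * ‖doubleChain R Φ (fun _ => α) θ₀ x y (k + τ) - θstar‖ ^ 2
              + 36 * ‖doubleChain R Φ (fun _ => α) θ₀ x y k - θstar‖ ^ 2
              + 63 * (r + ‖θstar‖) ^ 2)
          + (18 * ‖doubleChain R Φ (fun _ => α) θ₀ x y (k + τ) - θstar‖ ^ 2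
            + 18 * (r + ‖θstar‖) ^ 2)) := by
  set Θ := doubleChain R Φ (fun _ => α) θ₀ x y with hΘ
  set z := (x (k + τ), x (k + τ + 1), y (k + τ)) with hz
  set c := r + ‖θstar‖ with hc
  have hexp : ‖Θ (k + τ + 1) - θstar‖ ^ 2 = ‖Θ (k + τ) - θstar‖ ^ 2
      + 2 * α * inner ℝ (Θ (k + τ) - θstar) (meanUpdate P μ R Φ (Θ (k + τ)))
      + 2 * α * noise P μ R Φ θstar (Θ (k + τ)) z + α ^ 2 * ‖update R Φ z (Θ (k + τ))‖ ^ 2 := by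
    have h : Θ (k + τ + 1) - θstar = (Θ (k + τ) - θstar) + α • update R Φ z (Θ (k + τ)) := by
      rw [hΘ, doubleChain_succ]; abel
    rw [h, norm_add_sq_real, inner_smul_right, norm_smul, noise, inner_sub_right,
      Real.norm_eq_abs, mul_pow, sq_abs]
    ring
  have hmean : inner ℝ (Θ (k + τ) - θstar) (meanUpdate P μ R Φ (Θ (k + τ)))
      ≤ -(conditionNumber P μ Φ * ‖Θ (k + τ) - θstar‖ ^ 2) := by
    have h := inner_meanUpdate_sub hP hμ R Φ (Θ (k + τ)) θstar
    rw [hθ, sub_zero] at h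
    rw [h]
    exact neg_le_neg (conditionNumber_mul_sq_le hP hμ Φ _)
  have hupd : ‖update R Φ z (Θ (k + τ))‖ ^ 2 ≤ 18 * ‖Θ (k + τ) - θstar‖ ^ 2 + 18 * c ^ 2 := by
    have h := norm_update_le hR hΦ z (Θ (k + τ)) θstar
    rw [← hc] at h
    have h' := pow_le_pow_left₀ (norm_nonneg _) h 2
    nlinarith [sq_nonneg (‖Θ (k + τ) - θstar‖ - c)]
  have hnoise : 2 * (noise P μ R Φ θstar (Θ (k + τ)) z - noise P μ R Φ θstar (Θ k) z)
      ≤ α * ∑ j ∈ Finset.range τ, (45 * ‖Θ (k + j) - θstar‖ ^ 2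
        + 36 * ‖Θ (k + τ) - θstar‖ ^ 2 + 36 * ‖Θ k - θstar‖ ^ 2 + 63 * c ^ 2) := by
    have hr : 0 ≤ r := (abs_nonneg _).trans (hR (x 0))
    have hc0 : 0 ≤ c := add_nonneg hr (norm_nonneg _)
    have h1 := noise_sub_le hP hμ hR hΦ hθ (Θ (k + τ)) (Θ k) z
    have h2 := norm_doubleChain_add_sub_le hR hΦ hα θ₀ θstar x y k τ
    rw [← hΘ] at h2
    rw [← hc] at h1 h2
    have h3 := h1.trans (mul_le_mul_of_nonneg_right h2 (by positivity))
    refine (mul_le_mul_of_nonneg_left h3 two_pos.le).trans ?_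
    rw [Finset.sum_mul, Finset.mul_sum, Finset.mul_sum]
    refine Finset.sum_le_sum fun j _ => ?_
    set u := ‖Θ (k + j) - θstar‖
    set v := ‖Θ (k + τ) - θstar‖
    set w := ‖Θ k - θstar‖
    -- `2ab ≤ a² + b²` on every cross term; the `6` is the factor `2` of the noise times the step
    -- constant `3`.
    have h4 : 0 ≤ (45 * u ^ 2 + 36 * v ^ 2 + 36 * w ^ 2 + 63 * c ^ 2)
        - 6 * ((u + c) * (6 * v + 6 * w + 3 * c)) := by
      nlinarith [sq_nonneg (u - v), sq_nonneg (u - w), sq_nonneg (u - c), sq_nonneg (v - c),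
        sq_nonneg (w - c)]
    nlinarith [mul_nonneg hα h4]
  rw [hexp]
  have e1 := mul_le_mul_of_nonneg_left hmean (by linarith : 0 ≤ 2 * α)
  have e2 := mul_le_mul_of_nonneg_left hupd (sq_nonneg α)
  have e3 := mul_le_mul_of_nonneg_left hnoise hα
  linarith

/-- At a fixed `θ` the stationary mean of the noise is zero, and the delayed law is within `2α` of
the stationary one in `ℓ¹`. -/
lemma sum_tripleLaw_noise_le [DecidableEq S] {P : Matrix S S ℝ} (hP : IsStochastic P) {μ : S → ℝ}
    (hμ : IsStationary P μ) {R : S → ℝ} {r : ℝ} (hR : ∀ s, |R s| ≤ r)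
    {Φ : Matrix S (Fin d) ℝ} (hΦ : ∀ s, ‖feature Φ s‖ ≤ 1)
    (θstar θ : EuclideanSpace ℝ (Fin d)) {τ : ℕ} {α : ℝ} (hα : 0 ≤ α)
    (hτ : ∀ s, l1Dist P μ τ s ≤ α) (i j : S) :
    ∑ z, tripleLaw P ((P ^ τ) i) ((P ^ τ) j) z * noise P μ R Φ θstar θ z
      ≤ α * (9 * ‖θ - θstar‖ ^ 2 + 3 * (r + ‖θstar‖) ^ 2) := by
  have h := abs_sum_tripleLaw_mul_le (p := (P ^ τ) i) (q := (P ^ τ) j)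
    (h := fun z => inner ℝ (θ - θstar) (update R Φ z θ))
    (m := inner ℝ (θ - θstar) (meanUpdate P μ R Φ θ))
    (c := ‖θ - θstar‖ * (3 * (‖θ - θstar‖ + (r + ‖θstar‖)))) hP (hP.pow τ j) hμ.1
    (by simp only [meanUpdate, inner_sum, inner_smul_right])
    (sum_tripleLaw hP (hP.pow τ i) (hP.pow τ j))
    (fun z => (abs_real_inner_le_norm _ _).trans
      (mul_le_mul_of_nonneg_left (norm_update_le hR hΦ z θ θstar) (norm_nonneg _)))
    (hτ i) (hτ j)
  simp only [noise, inner_sub_right]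
  refine ((le_abs_self _).trans h).trans ?_
  have h4 : 0 ≤ (9 * ‖θ - θstar‖ ^ 2 + 3 * (r + ‖θstar‖) ^ 2)
      - 6 * (‖θ - θstar‖ * (‖θ - θstar‖ + (r + ‖θstar‖))) := by
    nlinarith [sq_nonneg (‖θ - θstar‖ - (r + ‖θstar‖))]
  nlinarith [mul_nonneg hα h4]

end Iterates

/-! ### The recursion for the mean square error. -/

section MeanSquare

variable {S Ω : Type*} [Fintype S] {d : ℕ} [MeasurableSpace S]
  [MeasurableSingletonClass S] [MeasurableSpace Ω] {Q : Measure Ω} [IsProbabilityMeasure Q]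

lemma integrable_norm_sq_doubleChain (R : S → ℝ) (Φ : Matrix S (Fin d) ℝ) (α : ℝ)
    (θ₀ θstar : EuclideanSpace ℝ (Fin d)) {s sHat : ℕ → Ω → S} (hs : ∀ t, Measurable (s t))
    (hsHat : ∀ t, Measurable (sHat t)) (t : ℕ) :
    Integrable (fun ω => ‖doubleChain R Φ (fun _ => α) θ₀ (fun t => s t ω)
      (fun t => sHat t ω) t - θstar‖ ^ 2) Q := by
  refine IsAdapted.integrable (k := t)
    (F := fun x y => ‖doubleChain R Φ (fun _ => α) θ₀ x y t - θstar‖ ^ 2) ?_ hs hsHat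
  intro x x' y y' hx hy
  simp only [isAdapted_doubleChain R Φ (fun _ => α) θ₀ t x x' y y' hx hy]

variable [DecidableEq S]

/-- The pathwise step is integrated. The delayed noise contributes `α²(18b + 6c²)` with `c = r +
‖θ*‖`, whence `36 = 18 + 18` and `24 = 18 + 6`; `117 = 45 + 36 + 36` collects the drift terms. -/
lemma meanSqError_succ_le {P : Matrix S S ℝ} (hP : IsStochastic P) {μ : S → ℝ}
    (hμ : IsStationary P μ) {R : S → ℝ} {r : ℝ} (hR : ∀ s, |R s| ≤ r)
    {Φ : Matrix S (Fin d) ℝ} (hΦ : ∀ s, ‖feature Φ s‖ ≤ 1)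
    {θstar : EuclideanSpace ℝ (Fin d)} (hθ : IsFixedPoint P μ R Φ θstar)
    (θ₀ : EuclideanSpace ℝ (Fin d)) {s sHat : ℕ → Ω → S} (hs : IsMarkovChain Q P s)
    (hsHat : IsMarkovChain Q P sHat)
    (hind : IndepFun (fun ω t => s t ω) (fun ω t => sHat t ω) Q) {τ : ℕ} {α : ℝ} (hα : 0 ≤ α)
    (hτ : ∀ s, l1Dist P μ τ s ≤ α) (k : ℕ) {b : ℝ}
    (hb : ∀ j ≤ k + τ, meanSqError Q R Φ α θ₀ θstar s sHat j ≤ b) :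
    meanSqError Q R Φ α θ₀ θstar s sHat (k + τ + 1)
      ≤ (1 - 2 * α * conditionNumber P μ Φ) * meanSqError Q R Φ α θ₀ θstar s sHat (k + τ)
        + α ^ 2 * (τ * (117 * b + 63 * (r + ‖θstar‖) ^ 2)
          + (36 * b + 24 * (r + ‖θstar‖) ^ 2)) := by
  have hθ' := meanUpdate_eq_zero hP hμ hθ
  set c := r + ‖θstar‖ with hc
  set Θ : ℕ → Ω → EuclideanSpace ℝ (Fin d) := fun j ω =>
    doubleChain R Φ (fun _ => α) θ₀ (fun t => s t ω) (fun t => sHat t ω) j with hΘ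
  set e : ℕ → ℝ := fun j => meanSqError Q R Φ α θ₀ θstar s sHat j with he
  set N : Ω → ℝ := fun ω => noise P μ R Φ θstar (Θ k ω)
    (s (k + τ) ω, s (k + τ + 1) ω, sHat (k + τ) ω) with hN
  have hsqint : ∀ j, Integrable (fun ω => ‖Θ j ω - θstar‖ ^ 2) Q := fun j =>
    integrable_norm_sq_doubleChain R Φ α θ₀ θstar hs.1 hsHat.1 j
  have heq : ∀ j, ∫ ω, ‖Θ j ω - θstar‖ ^ 2 ∂Q = e j := fun j => rfl
  have hNint : Integrable N Q := by
    refine IsAdapted.integrable (k := k + τ + 1)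
      (F := fun x y => noise P μ R Φ θstar (doubleChain R Φ (fun _ => α) θ₀ x y k)
        (x (k + τ), x (k + τ + 1), y (k + τ))) ?_ hs.1 hsHat.1
    intro x x' y y' hx hy
    have h := (isAdapted_doubleChain R Φ (fun _ => α) θ₀ k).mono
      (by omega : k ≤ k + τ + 1) x x' y y' hx hy
    simp only at h ⊢
    rw [h, hx (k + τ) (by omega), hx (k + τ + 1) le_rfl, hy (k + τ) (by omega)]
  have hNle : ∫ ω, N ω ∂Q ≤ α * (9 * e k + 3 * c ^ 2) := by
    have h := integral_adapted_triple_le hP hs hsHat hind τ k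
      (isAdapted_doubleChain R Φ (fun _ => α) θ₀ k) (noise P μ R Φ θstar)
      (fun θ => α * (9 * ‖θ - θstar‖ ^ 2 + 3 * c ^ 2))
      (fun θ i j => sum_tripleLaw_noise_le hP hμ hR hΦ θstar θ hα hτ i j)
    refine h.trans (le_of_eq ?_)
    rw [integral_const_mul, integral_add ((hsqint k).const_mul 9) (integrable_const _),
      integral_const_mul, heq]
    simp
  have hsumint : ∀ j, Integrable (fun ω => 45 * ‖Θ (k + j) ω - θstar‖ ^ 2
      + 36 * ‖Θ (k + τ) ω - θstar‖ ^ 2 + 36 * ‖Θ k ω - θstar‖ ^ 2 + 63 * c ^ 2) Q := fun j =>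
    ((((hsqint _).const_mul _).fun_add ((hsqint _).const_mul _)).fun_add ((hsqint _).const_mul _)).fun_add
      (integrable_const _)
  have hlastint : Integrable (fun ω => 18 * ‖Θ (k + τ) ω - θstar‖ ^ 2 + 18 * c ^ 2) Q :=
    ((hsqint _).const_mul _).fun_add (integrable_const _)
  have hsumval : ∀ j, ∫ ω, (45 * ‖Θ (k + j) ω - θstar‖ ^ 2
      + 36 * ‖Θ (k + τ) ω - θstar‖ ^ 2 + 36 * ‖Θ k ω - θstar‖ ^ 2 + 63 * c ^ 2) ∂Q
      = 45 * e (k + j) + 36 * e (k + τ) + 36 * e k + 63 * c ^ 2 := by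
    intro j
    rw [integral_add ((((hsqint _).const_mul _).fun_add ((hsqint _).const_mul _)).fun_add
        ((hsqint _).const_mul _)) (integrable_const _),
      integral_add (((hsqint _).const_mul _).fun_add ((hsqint _).const_mul _)) ((hsqint _).const_mul _),
      integral_add ((hsqint _).const_mul _) ((hsqint _).const_mul _),
      integral_const_mul, integral_const_mul, integral_const_mul, heq, heq, heq]
    simp
  have hlastval : ∫ ω, (18 * ‖Θ (k + τ) ω - θstar‖ ^ 2 + 18 * c ^ 2) ∂Q
      = 18 * e (k + τ) + 18 * c ^ 2 := by
    rw [integral_add ((hsqint _).const_mul _) (integrable_const _), integral_const_mul, heq]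
    simp
  have hsumint' := integrable_finsetSum (Finset.range τ) fun j _ => hsumint j
  have hrec : e (k + τ + 1) ≤ (1 - 2 * α * conditionNumber P μ Φ) * e (k + τ)
      + 2 * α * ∫ ω, N ω ∂Q
      + α ^ 2 * (∑ j ∈ Finset.range τ,
          (45 * e (k + j) + 36 * e (k + τ) + 36 * e k + 63 * c ^ 2)
        + (18 * e (k + τ) + 18 * c ^ 2)) := by
    have hmono := integral_mono (hsqint (k + τ + 1))
      ((((hsqint (k + τ)).const_mul (1 - 2 * α * conditionNumber P μ Φ)).fun_add
        (hNint.const_mul (2 * α))).fun_add ((hsumint'.fun_add hlastint).const_mul (α ^ 2)))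
      (fun ω => norm_sq_doubleChain_succ_le hP hμ hR hΦ hθ' hα θ₀ (fun t => s t ω)
        (fun t => sHat t ω) k τ)
    refine hmono.trans (le_of_eq ?_)
    rw [integral_add (((hsqint (k + τ)).const_mul _).fun_add (hNint.const_mul (2 * α)))
        ((hsumint'.fun_add hlastint).const_mul (α ^ 2)),
      integral_add ((hsqint (k + τ)).const_mul _) (hNint.const_mul (2 * α)),
      integral_const_mul, integral_const_mul, integral_const_mul, heq]
    rw [integral_add hsumint' hlastint, hlastval, integral_finsetSum _ fun j _ => hsumint j]
    simp only [hsumval]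
  have hsum : ∑ j ∈ Finset.range τ, (45 * e (k + j) + 36 * e (k + τ) + 36 * e k + 63 * c ^ 2)
      ≤ τ * (117 * b + 63 * c ^ 2) := by
    have h : ∀ j ∈ Finset.range τ, 45 * e (k + j) + 36 * e (k + τ) + 36 * e k + 63 * c ^ 2
        ≤ 117 * b + 63 * c ^ 2 := by
      intro j hj
      have h1 := hb (k + j) (by have := Finset.mem_range.1 hj; omega)
      have h2 := hb (k + τ) le_rfl
      have h3 := hb k (by omega)
      simp only [he]
      linarith
    simpa only [Finset.card_range, nsmul_eq_mul] using Finset.sum_le_card_nsmul _ _ _ h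
  have hbk : e k ≤ b := hb k (by omega)
  have hbt : e (k + τ) ≤ b := hb _ le_rfl
  have h1 : 2 * α * ∫ ω, N ω ∂Q ≤ α ^ 2 * (18 * b + 6 * c ^ 2) := by
    have := mul_le_mul_of_nonneg_left hNle (by linarith : 0 ≤ 2 * α)
    have := mul_le_mul_of_nonneg_left hbk (sq_nonneg α)
    linarith
  have h2 := mul_le_mul_of_nonneg_left hsum (sq_nonneg α)
  have h3 := mul_le_mul_of_nonneg_left hbt (sq_nonneg α)
  linarith

end MeanSquare

/-! ### The finite-time bound. -/

section FiniteTime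

variable {S Ω : Type*} [Fintype S] {d : ℕ} [MeasurableSpace S]
  [MeasurableSingletonClass S] [MeasurableSpace Ω] {Q : Measure Ω} [IsProbabilityMeasure Q]

lemma constB_nonneg {r : ℝ} (hr : 0 ≤ r) (θ₀ θstar : EuclideanSpace ℝ (Fin d)) :
    0 ≤ constB r θ₀ θstar := by
  unfold constB; positivity

lemma constG_nonneg (r : ℝ) (θ₀ θstar : EuclideanSpace ℝ (Fin d)) :
    0 ≤ constG r θ₀ θstar := by
  unfold constG; positivity

lemma constG_le {r : ℝ} (hr : 0 ≤ r) (θ₀ θstar : EuclideanSpace ℝ (Fin d)) :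
    constG r θ₀ θstar ≤ 72 * constB r θ₀ θstar ^ 2 := by
  have h1 : 0 ≤ r + ‖θstar‖ := by positivity
  have h2 : r + ‖θstar‖ ≤ constB r θ₀ θstar := by
    have := norm_nonneg (θ₀ - θstar)
    unfold constB; linarith
  have h3 := pow_le_pow_left₀ h1 h2 2
  unfold constG
  linarith

lemma meanSqError_le_of_forall_norm_le {R : S → ℝ} {Φ : Matrix S (Fin d) ℝ} {α : ℝ}
    {θ₀ θstar : EuclideanSpace ℝ (Fin d)} {s sHat : ℕ → Ω → S} (hs : ∀ t, Measurable (s t))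
    (hsHat : ∀ t, Measurable (sHat t)) {t : ℕ} {b : ℝ}
    (hb : ∀ x y : ℕ → S, ‖doubleChain R Φ (fun _ => α) θ₀ x y t - θstar‖ ≤ b) :
    meanSqError Q R Φ α θ₀ θstar s sHat t ≤ b ^ 2 := by
  have h := integral_mono (integrable_norm_sq_doubleChain (Q := Q) R Φ α θ₀ θstar hs hsHat t)
    (integrable_const (b ^ 2)) fun ω => pow_le_pow_left₀ (norm_nonneg _)
      (hb (fun t => s t ω) fun t => sHat t ω) 2
  rwa [integral_const, probReal_univ, one_smul] at h

variable [DecidableEq S]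

/-- The finite-time bound for a constant stepsize `α` and any time `τ` after which both chains
are `α`-close to stationarity. -/
theorem meanSqError_le {P : Matrix S S ℝ} (hP : IsStochastic P) {μ : S → ℝ}
    (hμ : IsStationary P μ) {R : S → ℝ} {r : ℝ} (hr : 0 ≤ r) (hR : ∀ s, |R s| ≤ r)
    {Φ : Matrix S (Fin d) ℝ} (hΦ : ∀ s, ‖feature Φ s‖ ≤ 1) (hd : 0 < d)
    {θstar : EuclideanSpace ℝ (Fin d)} (hθ : IsFixedPoint P μ R Φ θstar)
    (θ₀ : EuclideanSpace ℝ (Fin d)) {s sHat : ℕ → Ω → S} (hs : IsMarkovChain Q P s)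
    (hsHat : IsMarkovChain Q P sHat)
    (hind : IndepFun (fun ω t => s t ω) (fun ω t => sHat t ω) Q) {τ : ℕ} {α : ℝ} (hα : 0 < α)
    (hτ : ∀ s, l1Dist P μ τ s ≤ α)
    (hstep : α ≤ conditionNumber P μ Φ * constB r θ₀ θstar ^ 2
      / ((3 * (τ : ℝ) + 1) * constG r θ₀ θstar)) {T : ℕ} (hT : τ ≤ T) :
    meanSqError Q R Φ α θ₀ θstar s sHat T
      ≤ Real.exp (-2 * α * conditionNumber P μ Φ * ((T : ℝ) - τ)) * constB r θ₀ θstar ^ 2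
        + α * constG r θ₀ θstar * (3 * (τ : ℝ) + 1) / (2 * conditionNumber P μ Φ) := by
  set η := conditionNumber P μ Φ with hη
  set B := constB r θ₀ θstar with hB
  set G := constG r θ₀ θstar with hG
  set c := r + ‖θstar‖ with hc
  set e : ℕ → ℝ := fun j => meanSqError Q R Φ α θ₀ θstar s sHat j with he
  have hη3 : η ≤ 3 := conditionNumber_le_three hP hμ hΦ hd
  have hG0 : 0 ≤ G := constG_nonneg r θ₀ θstar
  have hτ0 : (0 : ℝ) ≤ τ := Nat.cast_nonneg τ
  have hGeq : G = 42 * B ^ 2 + 30 * c ^ 2 := rfl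
  -- If `G = 0`, division by zero would turn the stepsize condition into `α ≤ 0`. The condition thus
  -- also yields `η > 0` and `B ≠ 0`.
  have hden : 0 < (3 * (τ : ℝ) + 1) * G := by
    refine lt_of_le_of_ne (by positivity) fun h => ?_
    rw [← h, div_zero] at hstep
    linarith
  have hGpos : 0 < G := pos_of_mul_pos_right hden (by positivity)
  rw [le_div_iff₀ hden] at hstep
  have hηB : 0 < η * B ^ 2 := lt_of_lt_of_le (mul_pos hα hden) hstep
  have hηpos : 0 < η := pos_of_mul_pos_left hηB (sq_nonneg _)
  have hBpos : 0 < B ^ 2 := pos_of_mul_pos_right hηB hηpos.le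
  have hαη : α * (3 * τ + 1) * 42 ≤ η := by
    have h0 : 42 * B ^ 2 ≤ G := by linarith [sq_nonneg c]
    have h1 := mul_le_mul_of_nonneg_left h0 (by positivity : 0 ≤ α * (3 * τ + 1))
    refine le_of_mul_le_mul_right ?_ hBpos
    linarith
  have hατ : 3 * α * τ ≤ 1 / 14 := by nlinarith
  have hα14 : α ≤ 1 / 14 := by nlinarith
  have hfac : 0 ≤ 1 - 2 * α * η := by nlinarith
  -- deterministic bound up to time `τ`
  have hstart : ∀ j ≤ τ, e j ≤ B ^ 2 := by
    intro j hj
    refine meanSqError_le_of_forall_norm_le hs.1 hsHat.1 fun x y => ?_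
    have h1 := norm_doubleChain_sub_add_le hR hΦ hα.le θ₀ θstar x y j
    -- Growth by at most a factor `2`; then `2(‖θ₀ - θ*‖ + c) - c` is exactly `B`.
    have h2 : (1 + 3 * α) ^ j ≤ 2 := by
      calc (1 + 3 * α) ^ j ≤ Real.exp (3 * α) ^ j := by
            refine pow_le_pow_left₀ (by linarith) ?_ j
            linarith [Real.add_one_le_exp (3 * α)]
        _ = Real.exp (j * (3 * α)) := by rw [Real.exp_nat_mul]
        _ ≤ Real.exp (Real.log 2) := by
            refine Real.exp_le_exp.2 ?_
            have : (j : ℝ) ≤ τ := Nat.cast_le.2 hj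
            have := Real.log_two_gt_d9
            nlinarith
        _ = 2 := Real.exp_log two_pos
    have h3 := mul_le_mul_of_nonneg_right h2
      (by positivity : 0 ≤ ‖θ₀ - θstar‖ + (r + ‖θstar‖))
    rw [hB, constB]
    linarith
  have hrec : ∀ n, (∀ j ≤ n + τ, e j ≤ B ^ 2) →
      e (n + τ + 1) ≤ (1 - 2 * α * η) * e (n + τ) + α ^ 2 * ((3 * τ + 1) * G) := by
    intro n hn
    refine (meanSqError_succ_le hP hμ hR hΦ hθ θ₀ hs hsHat hind hα.le hτ n hn).trans ?_
    -- The coefficients of `G` dominate here: `117 ≤ 3·42`, `63 ≤ 3·30`, `36 ≤ 42`, `24 ≤ 30`.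
    have h : τ * (117 * B ^ 2 + 63 * c ^ 2) + (36 * B ^ 2 + 24 * c ^ 2)
        ≤ (3 * τ + 1) * G := by
      rw [hGeq]
      nlinarith [mul_nonneg hτ0 (sq_nonneg B), mul_nonneg hτ0 (sq_nonneg c), sq_nonneg B,
        sq_nonneg c]
    have := mul_le_mul_of_nonneg_left h (sq_nonneg α)
    linarith
  -- The stepsize condition bounds the additive term by `αηB²`, so the recursion sends `B²` to at
  -- most `(1 - αη)B²`.
  have hbdd : ∀ n, ∀ j ≤ n + τ, e j ≤ B ^ 2 := by
    intro n
    induction n with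
    | zero => intro j hj; exact hstart j (by omega)
    | succ n ih =>
      intro j hj
      rcases Nat.lt_or_ge j (n + τ + 1) with h | h
      · exact ih j (by omega)
      · obtain rfl : j = n + τ + 1 := by omega
        refine (hrec n ih).trans ?_
        have h1 := mul_le_mul_of_nonneg_left (ih (n + τ) le_rfl) hfac
        have h2 := mul_le_mul_of_nonneg_left hstep hα.le
        have h3 := mul_nonneg hα.le hηB.le
        linarith
  -- The fixed point of the affine recursion.
  set D := α * G * (3 * (τ : ℝ) + 1) / (2 * η) with hD
  have hD0 : 0 ≤ D := by positivity
  have hDeq : 2 * α * η * D = α ^ 2 * ((3 * τ + 1) * G) := by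
    rw [hD]; field_simp
  have hmain : ∀ n : ℕ, e (n + τ) ≤ Real.exp (-2 * α * η * n) * B ^ 2 + D := by
    intro n
    induction n with
    | zero =>
      have h0 := hstart τ le_rfl
      simpa using h0.trans (le_add_of_nonneg_right hD0)
    | succ n ih =>
      have h0 := hrec n (hbdd n)
      have h1 := mul_le_mul_of_nonneg_left ih hfac
      have h2 : (1 - 2 * α * η) * Real.exp (-2 * α * η * n)
          ≤ Real.exp (-2 * α * η * ((n + 1 : ℕ) : ℝ)) := by
        have h3 : -2 * α * η * ((n + 1 : ℕ) : ℝ) = -2 * α * η + -2 * α * η * n := by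
          push_cast; ring
        rw [h3, Real.exp_add]
        refine mul_le_mul_of_nonneg_right ?_ (Real.exp_pos _).le
        linarith [Real.add_one_le_exp (-2 * α * η)]
      have h4 := mul_le_mul_of_nonneg_right h2 hBpos.le
      rw [show n + 1 + τ = n + τ + 1 by omega]
      linarith
  obtain ⟨n, rfl⟩ := Nat.exists_eq_add_of_le' hT
  have h := hmain n
  rw [show ((n + τ : ℕ) : ℝ) - τ = n by push_cast; ring]
  exact h

end FiniteTime

/-! ### Rate and sample complexity for the stepsize `log T / (η T)`. -/

section Rate

lemma one_le_mixingFactor (C β : ℝ) : 1 ≤ mixingFactor C β := le_max_left _ _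

lemma log_natCast_ge {T : ℕ} (hT : 2 ≤ T) : 0.69 ≤ Real.log T := by
  have h1 : Real.log 2 ≤ Real.log T := Real.log_le_log two_pos (by exact_mod_cast hT)
  have := Real.log_two_gt_d9
  linarith

/-- With the stepsize `log T / (η T)`, the mixing time is of order `L log T`. -/
lemma IsGeometricMixing.mixingTime_le {S : Type*} [Fintype S] [DecidableEq S]
    {P : Matrix S S ℝ} {μ : S → ℝ} {C β : ℝ} (h : IsGeometricMixing P μ C β) {η : ℝ}
    (hη : 0 < η) (hη3 : η ≤ 3) {T : ℕ} (hT : 2 ≤ T) :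
    (mixingTime P μ (Real.log T / (η * T)) : ℝ) ≤ 6 * mixingFactor C β * Real.log T := by
  obtain ⟨hC, hβ0, hβ1, hmix⟩ := h
  have hlog := log_natCast_ge hT
  have hL := one_le_mixingFactor C β
  have hTpos : (0 : ℝ) < T := by exact_mod_cast (by omega : 0 < T)
  have hle : ∀ n : ℕ, C * β ^ n ≤ Real.log T / (η * T) →
      mixingTime P μ (Real.log T / (η * T)) ≤ n := fun n hn =>
    Nat.sInf_le fun s => (hmix n s).trans hn
  rcases hβ0.eq_or_lt with rfl | hβ
  · have h1 : mixingTime P μ (Real.log T / (η * T)) ≤ 1 := hle 1 (by simp; positivity)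
    have h2 : (mixingTime P μ (Real.log T / (η * T)) : ℝ) ≤ 1 := by exact_mod_cast h1
    nlinarith
  have hlβ : 0 < Real.log (1 / β) := Real.log_pos (by rw [lt_div_iff₀ hβ]; linarith)
  have hlC : 0 < Real.log C := Real.log_pos hC
  -- After `X` steps the distance is at most `e⁻²/T`; the extra `2` absorbs `η`, since `η ≤ 3 ≤ 5 ·
  -- 0.69 ≤ e² log T`.
  set X := mixingFactor C β * (Real.log T + 2) with hX
  have hX0 : 0 ≤ X := by positivity
  have hX1 : Real.log C + Real.log T + 2 ≤ X * Real.log (1 / β) := by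
    have h1 : (Real.log C + 1) ≤ mixingFactor C β * Real.log (1 / β) := by
      rw [← div_le_iff₀ hlβ]; exact le_max_right _ _
    have h2 := mul_le_mul_of_nonneg_right h1 (by linarith : 0 ≤ Real.log T + 2)
    nlinarith
  have hn : mixingTime P μ (Real.log T / (η * T)) ≤ ⌈X⌉₊ := by
    refine hle _ ?_
    have h1 : β ^ ⌈X⌉₊ ≤ Real.exp (-(Real.log C + Real.log T + 2)) := by
      rw [← Real.exp_log hβ, ← Real.exp_nat_mul]
      refine Real.exp_le_exp.2 ?_
      rw [one_div, Real.log_inv] at hX1 hlβ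
      have h2 := mul_le_mul_of_nonneg_right (Nat.le_ceil X) hlβ.le
      linarith
    have h2 : Real.exp (-(Real.log C + Real.log T + 2)) = C⁻¹ * (T : ℝ)⁻¹ * (Real.exp 2)⁻¹ := by
      rw [neg_add, neg_add, Real.exp_add, Real.exp_add, Real.exp_neg, Real.exp_neg,
        Real.exp_neg, Real.exp_log (by linarith), Real.exp_log hTpos]
    have h3 : (5 : ℝ) ≤ Real.exp 2 := by
      have := Real.quadratic_le_exp_of_nonneg (x := 2) (by norm_num)
      linarith
    calc C * β ^ ⌈X⌉₊ ≤ C * (C⁻¹ * (T : ℝ)⁻¹ * (Real.exp 2)⁻¹) := by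
          rw [← h2]; exact mul_le_mul_of_nonneg_left h1 (by linarith)
      _ = 1 / (Real.exp 2 * T) := by field_simp
      _ ≤ Real.log T / (η * T) := by
          rw [div_le_div_iff₀ (by positivity) (by positivity)]
          have : η ≤ Real.log T * Real.exp 2 := by nlinarith
          nlinarith
  have h1 : (mixingTime P μ (Real.log T / (η * T)) : ℝ) ≤ ⌈X⌉₊ := by exact_mod_cast hn
  have h2 := Nat.ceil_lt_add_one hX0
  nlinarith

variable {S Ω : Type*} [Fintype S] [DecidableEq S] {d : ℕ} [MeasurableSpace S]
  [MeasurableSingletonClass S] [MeasurableSpace Ω] {Q : Measure Ω} [IsProbabilityMeasure Q]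

/-- The rate for the stepsize `log T / (η T)`. -/
theorem meanSqError_log_le {P : Matrix S S ℝ} (hP : IsStochastic P) {μ : S → ℝ}
    (hμ : IsStationary P μ) {R : S → ℝ} {r : ℝ} (hr : 0 ≤ r) (hR : ∀ s, |R s| ≤ r)
    {Φ : Matrix S (Fin d) ℝ} (hΦ : ∀ s, ‖feature Φ s‖ ≤ 1) (hd : 0 < d)
    (hη : 0 < conditionNumber P μ Φ)
    {θstar : EuclideanSpace ℝ (Fin d)} (hθ : IsFixedPoint P μ R Φ θstar)
    (θ₀ : EuclideanSpace ℝ (Fin d)) {s sHat : ℕ → Ω → S} (hs : IsMarkovChain Q P s)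
    (hsHat : IsMarkovChain Q P sHat)
    (hind : IndepFun (fun ω t => s t ω) (fun ω t => sHat t ω) Q) {C β : ℝ}
    (hmix : IsGeometricMixing P μ C β) {T : ℕ} (hT : 2 ≤ T)
    (hbig : 2000 * mixingFactor C β / conditionNumber P μ Φ ^ 2 * Real.log T ^ 2 ≤ T) :
    meanSqError Q R Φ (Real.log T / (conditionNumber P μ Φ * T)) θ₀ θstar s sHat T
      ≤ 12 * constG r θ₀ θstar * mixingFactor C β / conditionNumber P μ Φ ^ 2
        * (Real.log T ^ 2 / T) := by
  have hη3 : conditionNumber P μ Φ ≤ 3 := conditionNumber_le_three hP hμ hΦ hd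
  have hτle := hmix.mixingTime_le hη hη3 hT
  set η := conditionNumber P μ Φ with hηdef
  set B := constB r θ₀ θstar with hB
  set G := constG r θ₀ θstar with hG
  set L := mixingFactor C β with hL
  set l := Real.log T with hl
  set α := l / (η * T) with hα
  set τ := mixingTime P μ α with hτ
  have hL1 : 1 ≤ L := one_le_mixingFactor C β
  have hl1 : 0.69 ≤ l := log_natCast_ge hT
  have hTpos : (0 : ℝ) < T := by exact_mod_cast (by omega : 0 < T)
  have hT1 : (1 : ℝ) ≤ T := by exact_mod_cast (by omega : 1 ≤ T)
  have hαpos : 0 < α := by positivity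
  have hG0 : 0 ≤ G := constG_nonneg r θ₀ θstar
  have hlL : l ≤ L * l := le_mul_of_one_le_left (by linarith) hL1
  have hτ20 : 3 * (τ : ℝ) + 1 ≤ 20 * L * l := by linarith
  have hbig' : 2000 * (L * l ^ 2) ≤ T * η ^ 2 := by
    rw [div_mul_eq_mul_div, div_le_iff₀ (by positivity)] at hbig
    linarith
  have hη9 : η ^ 2 ≤ 9 := (pow_le_pow_left₀ hη.le hη3 2).trans (by norm_num)
  -- For `B = 0` the stepsize condition fails, but then `θ₀ = θ*` and `r = ‖θ*‖ = 0`, so the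
  -- iterates never move.
  rcases (constB_nonneg hr θ₀ θstar).eq_or_lt with hB0 | hBpos
  · have hzero : meanSqError Q R Φ α θ₀ θstar s sHat T ≤ 0 ^ 2 := by
      refine meanSqError_le_of_forall_norm_le hs.1 hsHat.1 fun x y => ?_
      have h1 := norm_doubleChain_sub_add_le hR hΦ hαpos.le θ₀ θstar x y T
      have h2 : ‖θ₀ - θstar‖ = 0 := by
        rw [constB] at hB0
        linarith [norm_nonneg (θ₀ - θstar), norm_nonneg θstar]
      have h3 : r + ‖θstar‖ = 0 := by
        rw [constB] at hB0
        linarith [norm_nonneg (θ₀ - θstar), norm_nonneg θstar]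
      rw [h2, h3] at h1
      linarith
    rw [zero_pow two_ne_zero] at hzero
    refine hzero.trans ?_
    positivity
  have hG72 : G ≤ 72 * B ^ 2 := constG_le hr θ₀ θstar
  have hG42 : 42 * B ^ 2 ≤ G := by
    rw [hG, constG, ← hB]
    linarith [sq_nonneg (r + ‖θstar‖)]
  have hB2 : 0 < B ^ 2 := by positivity
  have hGpos : 0 < G := by linarith
  have hατ : α * (3 * τ + 1) ≤ 20 * (L * l ^ 2) / (η * T) := by
    calc α * (3 * τ + 1) ≤ α * (20 * L * l) := mul_le_mul_of_nonneg_left hτ20 hαpos.le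
      _ = _ := by rw [hα]; ring
  -- The `2000` gives `α(3τ + 1) ≤ η/100`, and `72/100 < 1`.
  have hstep : α ≤ η * B ^ 2 / ((3 * (τ : ℝ) + 1) * G) := by
    rw [le_div_iff₀ (by positivity), ← mul_assoc]
    have h1 : 20 * (L * l ^ 2) / (η * T) ≤ η / 100 := by
      rw [div_le_div_iff₀ (by positivity) (by norm_num)]
      linarith
    calc α * (3 * τ + 1) * G ≤ η / 100 * (72 * B ^ 2) :=
          mul_le_mul (hατ.trans h1) hG72 hG0 (by positivity)
      _ ≤ η * B ^ 2 := by linarith [mul_pos hη hB2]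
  have hLl : 0 ≤ L * l ^ 2 := by positivity
  have hτl : 9 * (τ * l) ≤ T := by
    have h1 : τ * l ≤ 6 * L * l * l := mul_le_mul_of_nonneg_right hτle (by linarith)
    have h2 : T * η ^ 2 ≤ T * 9 := mul_le_mul_of_nonneg_left hη9 hTpos.le
    linarith
  have hτT : τ ≤ T := by
    have h0 : (0 : ℝ) ≤ τ := Nat.cast_nonneg τ
    have h1 : τ * 0.69 ≤ τ * l := mul_le_mul_of_nonneg_left hl1 h0
    have h2 : (τ : ℝ) ≤ T := by linarith
    exact_mod_cast h2
  have hmain := meanSqError_le hP hμ hr hR hΦ hd hθ θ₀ hs hsHat hind hαpos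
    (fun s => hmix.l1Dist_mixingTime_le hαpos s) hstep hτT
  refine hmain.trans ?_
  rw [← hηdef, ← hB, ← hG, ← hτ]
  set q := L * l ^ 2 / (η ^ 2 * T) with hq
  have hgoal : 12 * G * L / η ^ 2 * (l ^ 2 / T) = G * (2 * q) + G * (10 * q) := by
    rw [hq]; field_simp; norm_num
  rw [hgoal]
  refine add_le_add ?_ ?_
  -- The delay costs at most `1` in the exponent, so the transient is at most `e/T²`; only `3/T` is
  -- kept.
  · have h1 : -2 * α * η * ((T : ℝ) - τ) ≤ 1 + (-l + -l) := by
      have h2 : -2 * α * η * ((T : ℝ) - τ) = 2 * (τ * l) / T - 2 * l := by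
        rw [hα]; field_simp; ring
      have h3 : 2 * (τ * l) / T ≤ 1 := by
        rw [div_le_one hTpos]
        have : (0 : ℝ) ≤ τ * l := by positivity
        linarith
      linarith
    have h4 : Real.exp (-2 * α * η * ((T : ℝ) - τ)) ≤ 3 * (1 / T) := by
      refine (Real.exp_le_exp.2 h1).trans ?_
      rw [Real.exp_add, Real.exp_add, Real.exp_neg, hl, Real.exp_log hTpos]
      have h5 : (T : ℝ)⁻¹ ≤ 1 := inv_le_one_of_one_le₀ hT1
      have h6 : (0 : ℝ) < (T : ℝ)⁻¹ := by positivity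
      have h7 := Real.exp_one_lt_d9
      have h8 : Real.exp 1 ≤ 3 := by linarith
      rw [one_div]
      exact mul_le_mul h8 (mul_le_of_le_one_right h6.le h5) (by positivity) (by norm_num)
    have h5 : 1 / (T : ℝ) ≤ 21 * q := by
      rw [hq, ← mul_div_assoc, div_le_div_iff₀ hTpos (by positivity)]
      have h6 : 0.69 ^ 2 ≤ l ^ 2 := pow_le_pow_left₀ (by norm_num) hl1 2
      have h7 : l ^ 2 ≤ L * l ^ 2 := le_mul_of_one_le_left (sq_nonneg _) hL1
      have h8 : η ^ 2 ≤ 21 * (L * l ^ 2) := by linarith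
      rw [one_mul]
      exact mul_le_mul_of_nonneg_right h8 hTpos.le
    calc Real.exp (-2 * α * η * ((T : ℝ) - τ)) * B ^ 2 ≤ (3 * (1 / T)) * (G / 42) :=
          mul_le_mul h4 (by linarith) hB2.le (by positivity)
      _ ≤ (3 * (21 * q)) * (G / 42) :=
          mul_le_mul_of_nonneg_right (by linarith) (by positivity)
      _ ≤ G * (2 * q) := by
          have : 0 ≤ G * q := by positivity
          linarith
  · calc α * G * (3 * τ + 1) / (2 * η) = (α * (3 * τ + 1)) * (G / (2 * η)) := by ring
      _ ≤ (20 * (L * l ^ 2) / (η * T)) * (G / (2 * η)) :=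
          mul_le_mul_of_nonneg_right hατ (by positivity)
      _ = G * (10 * q) := by rw [hq]; field_simp; norm_num

/-- `T ≥ K N log² (2 + N)` forces `T ≥ 2000 N log² T`, for a large absolute constant `K`. -/
lemma mul_log_sq_le_of_le {N T : ℝ} (hN : 1 / 9 ≤ N)
    (hT : 10 ^ 11 * N * Real.log (2 + N) ^ 2 ≤ T) :
    2 ≤ T ∧ 2000 * N * Real.log T ^ 2 ≤ T := by
  have hN0 : 0 < N := by linarith
  have hl : 0.69 ≤ Real.log (2 + N) := by
    have h1 : Real.log 2 ≤ Real.log (2 + N) := Real.log_le_log two_pos (by linarith)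
    have := Real.log_two_gt_d9
    linarith
  set l := Real.log (2 + N) with hldef
  set u := T / N with hu
  have hul : 10 ^ 11 * l ^ 2 ≤ u := by
    rw [hu, le_div_iff₀ hN0]; linarith
  have hl2 : 0.47 ≤ l ^ 2 := by nlinarith
  have hubig : 10 ^ 10 * 4.7 ≤ u := by linarith
  have hu0 : 0 < u := by linarith
  have hTu : T = u * N := by rw [hu]; field_simp
  have hT2 : 2 ≤ T := by rw [hTu]; nlinarith
  refine ⟨hT2, ?_⟩
  -- With `w = u^(1/4)`, `log u = 4 log w ≤ 4w`, so `log² T ≤ 32√u + 2l²`; `√u ≥ 200000` beats the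
  -- factor `2000 · 32`.
  set v := Real.sqrt u with hv
  set w := Real.sqrt v with hw
  have hv2 : v ^ 2 = u := Real.sq_sqrt hu0.le
  have hw2 : w ^ 2 = v := Real.sq_sqrt (Real.sqrt_nonneg _)
  have hv0 : 0 < v := Real.sqrt_pos.2 hu0
  have hw0 : 0 < w := Real.sqrt_pos.2 hv0
  have hvbig : 200000 ≤ v := by
    rw [hv]; exact Real.le_sqrt_of_sq_le (by linarith)
  have hlogu : Real.log u ≤ 4 * w := by
    have h1 : u = w ^ 4 := by rw [← hv2, ← hw2]; ring
    have h2 : Real.log w ≤ w := Real.log_le_self hw0.le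
    rw [h1, Real.log_pow]
    push_cast
    linarith
  have hlogT : Real.log T ≤ 4 * w + l := by
    rw [hTu, Real.log_mul hu0.ne' hN0.ne']
    have : Real.log N ≤ l := Real.log_le_log hN0 (by linarith)
    linarith
  have hsq : Real.log T ^ 2 ≤ 32 * v + 2 * l ^ 2 := by
    have h1 := pow_le_pow_left₀ (Real.log_nonneg (by linarith)) hlogT 2
    rw [← hw2]
    nlinarith [sq_nonneg (4 * w - l)]
  have h3 : 2000 * Real.log T ^ 2 ≤ u := by nlinarith
  rw [hTu] at h3 ⊢
  nlinarith

end Rate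

end AvgRewardTD

end

/-! ### Assembly of the theorem. -/

open AvgRewardTD in
theorem theorem2 :
    -- an absolute constant, used only for the rate and the sample complexity
    ∃ K : ℝ, 0 < K ∧
    ∀ (S A : Type*) [Fintype S] [DecidableEq S] [MeasurableSpace S] [MeasurableSingletonClass S]
      [Fintype A] (M : MDP S A) (π : Policy S A)
      (_ : (M.transMatrix π).IsIrreducible) (_ : IsAperiodic (M.transMatrix π))
      (μ : S → ℝ) (_ : IsStationary (M.transMatrix π) μ)
      (d : ℕ) (_ : 0 < d) (Φ : Matrix S (Fin d) ℝ)
      (_ : ∀ s, ‖feature Φ s‖ ≤ 1) (_ : LinearIndependent ℝ Φ.col)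
      (θstar : EuclideanSpace ℝ (Fin d))
      (_ : IsFixedPoint (M.transMatrix π) μ (M.expReward π) Φ θstar)
      (θ₀ : EuclideanSpace ℝ (Fin d))
      (Ω : Type*) [MeasurableSpace Ω] (Q : Measure Ω) [IsProbabilityMeasure Q]
      (s sHat : ℕ → Ω → S)
      (_ : IsMarkovChain Q (M.transMatrix π) s) (_ : IsMarkovChain Q (M.transMatrix π) sHat)
      (_ : IndepFun (fun ω t => s t ω) (fun ω t => sHat t ω) Q),
      let P := M.transMatrix π
      let η := conditionNumber P μ Φ
      let B := constB M.rMax θ₀ θstar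
      let G := constG M.rMax θ₀ θstar
      let err := fun (α : ℝ) (T : ℕ) =>
        meanSqError Q (M.expReward π) Φ α θ₀ θstar s sHat T
      -- the finite-time bound
      (∀ α : ℝ, 0 < α →
        α ≤ η * B ^ 2 / ((3 * (mixingTime P μ α : ℝ) + 1) * G) →
        ∀ T : ℕ, mixingTime P μ α ≤ T →
          err α T ≤ Real.exp (-2 * α * η * ((T : ℝ) - mixingTime P μ α)) * B ^ 2
            + α * G * (3 * (mixingTime P μ α : ℝ) + 1) / (2 * η)) ∧
      -- the chain mixes geometrically
      (∃ C β : ℝ, IsGeometricMixing P μ C β) ∧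
      -- for the stepsize `log T / (η T)`: rate and sample complexity
      (∀ C β : ℝ, IsGeometricMixing P μ C β →
        let L := mixingFactor C β
        (∀ T : ℕ, 2 ≤ T → K * L / η ^ 2 * Real.log T ^ 2 ≤ T →
          err (Real.log T / (η * T)) T ≤ K * G * L / η ^ 2 * (Real.log T ^ 2 / T)) ∧
        (∀ ε : ℝ, 0 < ε → ε ≤ 1 →
          let N := (1 + G) * L * ε⁻¹ * (η ^ 2)⁻¹
          ∀ T : ℕ, K * N * Real.log (2 + N) ^ 2 ≤ T →
            err (Real.log T / (η * T)) T ≤ ε)) := by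
  -- Only the inversion of the logarithm needs a constant this large; the rate needs `2000` and
  -- `12`.
  refine ⟨10 ^ 11, by norm_num, ?_⟩
  intro S A _ _ _ _ _ M π hirr hap μ hμ d hd Φ hΦ hΦi θstar hθ θ₀ Ω _ Q _ s sHat hs hsHat hind
    P η B G err
  have hP : IsStochastic P := M.isStochastic_transMatrix π
  have hprim : P.IsPrimitive := hP.isPrimitive hirr hap
  have hη : 0 < η := conditionNumber_pos hP hμ hprim hΦi hd
  have hη3 : η ≤ 3 := conditionNumber_le_three hP hμ hΦ hd
  have hr := M.rMax_nonneg
  have hR := M.abs_expReward_le π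
  have hG : 0 ≤ G := constG_nonneg _ _ _
  have hgeo := exists_isGeometricMixing hP hprim hμ
  refine ⟨fun α hα hstep T hT => ?_, hgeo, fun C β hmix => ?_⟩
  · obtain ⟨C, β, hmix⟩ := hgeo
    exact meanSqError_le hP hμ hr hR hΦ hd hθ θ₀ hs hsHat hind hα
      (hmix.l1Dist_mixingTime_le hα) hstep hT
  intro L
  have hL : 1 ≤ L := one_le_mixingFactor C β
  have hrate : ∀ T : ℕ, 2 ≤ T → 2000 * L / η ^ 2 * Real.log T ^ 2 ≤ T →
      err (Real.log T / (η * T)) T ≤ 12 * G * L / η ^ 2 * (Real.log T ^ 2 / T) :=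
    fun T hT hbig => meanSqError_log_le hP hμ hr hR hΦ hd hη hθ θ₀ hs hsHat hind hmix hT hbig
  refine ⟨fun T hT hbig => ?_, fun ε hε hε1 => ?_⟩
  · refine (hrate T hT (le_trans ?_ hbig)).trans ?_
    · gcongr; norm_num
    · gcongr; norm_num
  · intro N T hT
    have hLη : 0 ≤ L / η ^ 2 := by positivity
    have hNeq : ε * N = (1 + G) * (L / η ^ 2) := by
      simp only [N]; field_simp
    -- The `1` in `1 + G` makes `N` dominate `L / η²` even when `G` is small, so the largeness
    -- condition of the rate follows from the one with `N`.
    have hN1 : L / η ^ 2 ≤ N := by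
      have h1 : N = ε⁻¹ * ((1 + G) * (L / η ^ 2)) := by simp only [N]; ring
      have h2 : 1 ≤ ε⁻¹ := (one_le_inv₀ hε).2 hε1
      have h3 : L / η ^ 2 ≤ (1 + G) * (L / η ^ 2) := le_mul_of_one_le_left hLη (by linarith)
      rw [h1]
      exact h3.trans (le_mul_of_one_le_left (by positivity) h2)
    have hN9 : 1 / 9 ≤ N := by
      refine le_trans ?_ hN1
      have : η ^ 2 ≤ 9 := (pow_le_pow_left₀ hη.le hη3 2).trans (by norm_num)
      exact div_le_div₀ (by linarith) hL (by positivity) this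
    obtain ⟨hT2, hTlog⟩ := mul_log_sq_le_of_le hN9 hT
    have hTpos : (0 : ℝ) < T := by linarith
    refine (hrate T (by exact_mod_cast hT2) (le_trans ?_ hTlog)).trans ?_
    · rw [mul_div_assoc]
      gcongr
    · have h1 : 12 * G * L / η ^ 2 * (Real.log T ^ 2 / T)
          = 12 * (G * (L / η ^ 2)) * Real.log T ^ 2 / T := by ring
      rw [h1, div_le_iff₀ hTpos]
      -- The `G` in `1 + G` bounds the error by `12 ε N log² T / T`, at most `12ε/2000`.
      have h2 : G * (L / η ^ 2) ≤ ε * N := by rw [hNeq]; linarith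
      have h3 : 12 * (G * (L / η ^ 2)) * Real.log T ^ 2 ≤ 12 * (ε * N) * Real.log T ^ 2 := by
        gcongr
      have h4 : ε * (2000 * N * Real.log T ^ 2) ≤ ε * T := mul_le_mul_of_nonneg_left hTlog hε.le
      have h5 : 0 ≤ ε * N * Real.log T ^ 2 := by
        have : 0 ≤ N := by linarith
        positivity
      linarith
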